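/- **Setting.** Let $\mathcal M=(\mathcal S,\mathcal A,\{p_h\}_{h\in[H]},s_1,H)$ be a tabular finite-horizon MDP with $S=|\mathcal S|$ states, $A=|\mathcal A|\ge 1$ actions, horizon $H$, transition probabilities $p_h(s'\mid s,a)$ and initial state $s_1$. For a (possibly stochastic) policy $\pi$ let $\mathbb P^\pi$ be the law of the trajectory $(s_1,a_1,\dots,s_H,a_H)$ of one episode in which $\pi$ is executed, and let $p_h^\pi(s,a)=\mathbb P^\pi(s_h=s,a_h=a)$. For a reward function $r$ let $V_1^\pi(s_1;r)=\sum_{h,s,a}p_h^\pi(s,a)r_h(s,a)$ and $V_1^\star(s_1;r)=\max_\pi V_1^\pi(s_1;r)$. At the beginning of each episode $t\ge 1$ a reward function $r^t$ is revealed to the learner, who then plays a policy $\pi^t$ and observes the trajectory $(s_h^t,a_h^t)_{h\in[H]}$. The rewards may depend on the past episodes (and on extra randomness). Formally, there is a filtration $(\mathcal F_t)_{t\ge 0}$ such that $r^t$ and $\pi^t$ are $\mathcal F_{t-1}$-measurable, the trajectory of episode $t$ is $\mathcal F_t$-measurable, and its conditional law given $\mathcal F_{t-1}$ is $\mathbb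 P^{\pi^t}$. Assume that for all $t$, $r_h^t(s,a)\in[0,1]$ for all $h,s,a$, and $\sum_{h,s,a}r_h^t(s,a)\le 1$. **Algorithm (UCBVI for changing rewards, with parameter $\delta\in(0,1)$).** Let $n_h^t(s,a)=\sum_{j=1}^t\mathbf 1\{s_h^j=s,a_h^j=a\}$, let $\widehat p_h^{\,t}(s'\mid s,a)$ be the empirical frequency of the next state $s'$ among these visits, $\widehat P^t_{h,s,a}V=\sum_{s'}\widehat p_h^{\,t}(s'\mid s,a)V(s')$, let $\mathbb V(P,V)$ be the variance of $V$ under $P$, and let $\beta(n,\delta)=\log(2SAH/\delta)+S\log(8e(n+1))$. Define backwards in $h$: $\overline Q_H^t(s,a;r)=r_H(s,a)$ and, for $h<H$, $$\overline Q_h^t(s,a;r)=\min\Big\{1,\ r_h(s,a)+\widehat P^t_{h,s,a}\overline V_{h+1}^t(r)+B_h^t(s,a;r)\Big\},\qquad \overline V_{h+1}^t(s;r)=\max_a\overline Q_{h+1}^t(s,a;r),$$ $$B_h^t(s,a;r)=\max\left\{\sqrt{\frac{8\,\mathbb V(\widehat P^t_{h,s,a},\overline V^t_{h+1}(r))\,\beta(n_h^t(s,a),\delta)}{n_h^t(s,a)}},\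 \frac{8\,\beta(n_h^t(s,a),\delta)}{n_h^t(s,a)}\right\},$$ with $B_h^t(s,a;r)=+\infty$ (hence $\overline Q_h^t(s,a;r)=1$) if $n_h^t(s,a)=0$. In episode $t$ the algorithm plays a deterministic policy with $\pi_h^t(s)\in\arg\max_a\overline Q_h^{t-1}(s,a;r^t)$ for all $h,s$, ties being broken arbitrarily. **Theorem.** With probability at least $1-\delta$, for all $T\in\mathbb N$ simultaneously, $$\sum_{t=1}^T\Big(V_1^\star(s_1;r^t)-V_1^{\pi^t}(s_1;r^t)\Big)\le 5140\,SAH^2L_{T,\delta}+256\sqrt{SAH\,L_{T,\delta}\sum_{t=1}^TV_1^{\pi^t}(s_1;r^t)},$$ where $L_{T,\delta}=\big(\log(2SAH/\delta)+6S\big)\log(T+1)^2$. -/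

import Mathlib

open MeasureTheory

namespace ChangingRewardRL

/-- A tabular finite-horizon Markov decision process with state space `S`, action space `A` and
horizon `H`. The stages `1, …, H` are indexed by `Fin H` (so the first stage has index `0`);
`p h s a s'` is the probability to move to `s'` when action `a` is taken in state `s` at stage
`h`, and `s₁` is the initial state. -/
structure TabularMDP (S A : Type*) [Fintype S] (H : ℕ) where
  /-- The transition function at each stage. -/
  p : Fin H → S → A → stdSimplex ℝ S
  /-- The initial state. -/
  s₁ : S

/-- The state-action pairs `(s_1, a_1), …, (s_H, a_H)` observed during one episode. -/
abbrev Trajectory (S A : Type*) (H : ℕ) := Fin H → S × A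

/-- A reward function `r_h(s, a)`. -/
abbrev Reward (S A : Type*) (H : ℕ) := Fin H → S → A → ℝ

/-- A stochastic policy: `π h s a` is the probability to play `a` in state `s` at stage `h`. -/
abbrev Policy (S A : Type*) [Fintype A] (H : ℕ) := Fin H → S → stdSimplex ℝ A

/-- A deterministic policy: `π h s` is the action played in state `s` at stage `h`. -/
abbrev DetPolicy (S A : Type*) (H : ℕ) := Fin H → S → A

/-- A deterministic policy, seen as a stochastic one. -/
noncomputable def DetPolicy.toPolicy {S A : Type*} {H : ℕ} [Fintype A] [DecidableEq A]
    (π : DetPolicy S A H) : Policy S A H :=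
  fun h s => stdSimplex.vertex (π h s)

/-- The rewards lie in `[0, 1]` and their total mass is at most `1`. -/
def Reward.IsAdmissible {S A : Type*} {H : ℕ} [Fintype S] [Fintype A] (r : Reward S A H) : Prop :=
  (∀ h s a, r h s a ∈ Set.Icc (0 : ℝ) 1) ∧ ∑ h, ∑ s, ∑ a, r h s a ≤ 1

section Model

variable {S A : Type*} {H : ℕ} [Fintype S] [Fintype A] [DecidableEq S] [DecidableEq A]

/-- The probability that the state at stage `h` of the trajectory `x` is reached from the previous
state-action pair of `x`; at the first stage, the indicator that this state is the initial one. -/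
noncomputable def TabularMDP.entryProb (M : TabularMDP S A H) (x : Trajectory S A H)
    (h : Fin H) : ℝ :=
  if h.val = 0 then (if (x h).1 = M.s₁ then 1 else 0)
  else
    let h' : Fin H := ⟨h.val - 1, lt_of_le_of_lt (Nat.sub_le _ _) h.isLt⟩
    M.p h' (x h').1 (x h').2 (x h).1

/-- The probability `ℙ^π` of the trajectory `x` when `π` is executed for one episode. -/
noncomputable def TabularMDP.trajProb (M : TabularMDP S A H) (π : Policy S A H)
    (x : Trajectory S A H) : ℝ :=
  ∏ h : Fin H, M.entryProb x h * π h (x h).1 (x h).2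

/-- The state-action distribution `p_h^π(s, a) = ℙ^π(s_h = s, a_h = a)`. -/
noncomputable def TabularMDP.occupancy (M : TabularMDP S A H) (π : Policy S A H)
    (h : Fin H) (s : S) (a : A) : ℝ :=
  ∑ x : Trajectory S A H with x h = (s, a), M.trajProb π x

/-- The expected return `V_1^π(s_1; r) = ∑_{h,s,a} p_h^π(s, a) r_h(s, a)`. -/
noncomputable def TabularMDP.value (M : TabularMDP S A H) (π : Policy S A H)
    (r : Reward S A H) : ℝ :=
  ∑ h, ∑ s, ∑ a, M.occupancy π h s a * r h s a

/-- The optimal expected return `V_1^⋆(s_1; r)`, the maximum of `V_1^π(s_1; r)` over all stochastic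
policies. -/
noncomputable def TabularMDP.optValue (M : TabularMDP S A H) (r : Reward S A H) : ℝ :=
  ⨆ π : Policy S A H, M.value π r

/-! In the following, `X j` is the trajectory of the `(j + 1)`-st episode, and `t` is the number
of episodes that have been observed, namely those of the trajectories `X 0, …, X (t - 1)`. -/

/-- The number `n_h^t(s, a)` of visits to `(s, a)` at stage `h` during the first `t` episodes. -/
def visits (X : ℕ → Trajectory S A H) (t : ℕ) (h : Fin H) (s : S) (a : A) : ℕ :=
  ((Finset.range t).filter fun j => X j h = (s, a)).card

/-- The number of transitions from `(s, a)` at stage `h` to `s'` at stage `h + 1` during the first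
`t` episodes, for `h` that is not the last stage. -/
def transitions (X : ℕ → Trajectory S A H) (t : ℕ) (h : Fin H) (hh : h.val + 1 < H)
    (s : S) (a : A) (s' : S) : ℕ :=
  ((Finset.range t).filter fun j => X j h = (s, a) ∧ (X j ⟨h.val + 1, hh⟩).1 = s').card

/-- The empirical (maximum likelihood) transition probabilities after `t` episodes; only used
when `(s, a)` has been visited at stage `h`. -/
noncomputable def empTransition (X : ℕ → Trajectory S A H) (t : ℕ) (h : Fin H)
    (hh : h.val + 1 < H) (s : S) (a : A) (s' : S) : ℝ :=
  (transitions X t h hh s a s' : ℝ) / (visits X t h s a : ℝ)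

/-- The expectation `∑_{s'} P(s') V(s')`. -/
def mean (P V : S → ℝ) : ℝ := ∑ s', P s' * V s'

/-- The variance of `V` under `P`. -/
def variance (P V : S → ℝ) : ℝ := ∑ s', P s' * (V s' - mean P V) ^ 2

variable (S A H) in
/-- The threshold `β(n, δ) = log (2 S A H / δ) + S log (8 e (n + 1))`. -/
noncomputable def beta (δ : ℝ) (n : ℕ) : ℝ :=
  Real.log (2 * Fintype.card S * Fintype.card A * H / δ) +
    Fintype.card S * Real.log (8 * Real.exp 1 * (n + 1))

variable (A H) in
/-- The Bernstein-type bonus for a state-action pair that has been visited `n ≥ 1` times, where `P`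
is the empirical distribution of the next state and `V` the upper bound at the next stage. -/
noncomputable def bonus (δ : ℝ) (n : ℕ) (P V : S → ℝ) : ℝ :=
  max (Real.sqrt (8 * variance P V * beta S A H δ n / n)) (8 * beta S A H δ n / n)

/-- The upper confidence bound `Q̄_h^t(s, a; r)` built from the first `t` episodes. It is `r_H(s, a)`
at the last stage. Before it, it is the minimum of `1` and the sum of the reward, of the empirical
expectation of `V̄_{h+1}^t(·; r) = max_a Q̄_{h+1}^t(·, a; r)` and of the bonus. The bonus is infinite
when `(s, a)` has not been visited at stage `h`, so that the bound is `1` in that case. -/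
noncomputable def upperQ [Nonempty A] (δ : ℝ) (X : ℕ → Trajectory S A H) (t : ℕ)
    (r : Reward S A H) (h : Fin H) (s : S) (a : A) : ℝ :=
  if hh : h.val + 1 < H then
    if visits X t h s a = 0 then 1
    else
      let V : S → ℝ := fun s' => Finset.univ.sup' Finset.univ_nonempty
        fun a' => upperQ δ X t r ⟨h.val + 1, hh⟩ s' a'
      min (r h s a + mean (empTransition X t h hh s a) V +
        bonus A H δ (visits X t h s a) (empTransition X t h hh s a) V) 1
  else r h s a
termination_by H - h.val

variable {Ω : Type*} {mΩ : MeasurableSpace Ω}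

/-- `UCBVI` with confidence parameter `δ` interacts with the MDP `M`. Here `r t`, `π t` and `X t`
are the reward function, the policy and the trajectory of the `(t + 1)`-st episode, and `ℱ t` is
the information available when that episode begins. The reward function is revealed in advance, but
may depend on the past (and on extra randomness); ties in the greedy choice are broken
arbitrarily. -/
structure IsUCBVIRun [Nonempty A] (M : TabularMDP S A H) (δ : ℝ) (μ : Measure Ω)
    (ℱ : Filtration ℕ mΩ) (r : ℕ → Ω → Reward S A H) (π : ℕ → Ω → DetPolicy S A H)
    (X : ℕ → Ω → Trajectory S A H) : Prop where
  /-- The reward function is known at the beginning of the episode. -/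
  reward_measurable : ∀ t h s a, Measurable[ℱ t] fun ω => r t ω h s a
  /-- The policy is chosen at the beginning of the episode. -/
  policy_measurable : ∀ t π₀, MeasurableSet[ℱ t] {ω | π t ω = π₀}
  /-- The trajectory is known at the end of the episode. -/
  trajectory_measurable : ∀ t x, MeasurableSet[ℱ (t + 1)] {ω | X t ω = x}
  /-- Given the past, the trajectory follows the law of an episode in which the chosen policy is
  executed on the MDP. -/
  trajectory_law : ∀ t x, μ[Set.indicator {ω | X t ω = x} (fun _ => (1 : ℝ)) | ℱ t] =ᵐ[μ]
    fun ω => M.trajProb (π t ω).toPolicy x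
  /-- The policy is greedy with respect to the upper confidence bound for the current reward
  function that is built from the previous episodes. -/
  greedy : ∀ t ω h s a, upperQ δ (fun j => X j ω) t (r t ω) h s a ≤
    upperQ δ (fun j => X j ω) t (r t ω) h s (π t ω h s)

end Model

/-- The logarithmic factor `L_{T,δ} = (log (2 S A H / δ) + 6 S) log (T + 1)²`. -/
noncomputable def logFactor (S A : Type*) [Fintype S] [Fintype A] (H : ℕ) (δ : ℝ) (T : ℕ) : ℝ :=
  (Real.log (2 * Fintype.card S * Fintype.card A * H / δ) + 6 * Fintype.card S) *
    Real.log (T + 1) ^ 2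

end ChangingRewardRL

/-! The regret bound is deterministic on an event of probability at least `1 - δ` that does not
mention the rewards, so rewards depending on the past cost nothing.

On this event every empirical transition law is within Kullback–Leibler radius `β(n, δ) / n` of the
true one, expressed by `DVBound`. Testing that bound against well-chosen functions gives an
empirical Bernstein inequality for all `[0, 1]`-valued functions at once (`DVBound.mean_sub_le`),
and a comparison of variances. Hence the upper bounds are optimistic
(`TransitionsConcentrate.actionValue_le`), and the gap between the upper bound and the value of the
greedy policy obeys a backward recursion with factor `1 + 1 / H`. Unrolling it costs at most a
factor `3` and bounds the regret of one episode by occupancy sums of `√(variance · width)` and `H ·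
width` (`TransitionsConcentrate.optValue_sub_value_le`).

Over the episodes, Cauchy–Schwarz separates two sums. The variances add up to at most twice the
collected value, because total reward mass at most `1` keeps all values below `1`
(`TabularMDP.sum_nextVariance_le`). The widths add up logarithmically for each `(h, s, a)`, because
visit counts are comparable to cumulated occupancies (`VisitsConcentrate.sum_confWidth_le`).

The event is controlled by Ville's inequality for products of conditional likelihood ratios
(`IsUCBVIRun.measure_exists_le_prod_le`): Laplace's rule of succession against the true kernel for
the transitions, an exponential supermartingale for the visits. Both hold for all times
simultaneously, and a union bound over `(h, s, a)` finishes. -/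

namespace ChangingRewardRL

set_option linter.unusedSectionVars false

/-! ### Bernstein-type inequalities from a Kullback–Leibler bound. -/

section Analysis

variable {S : Type*} [Fintype S] {p q f g : S → ℝ} {α : ℝ}

lemma mean_add (P f g : S → ℝ) : mean P (fun s => f s + g s) = mean P f + mean P g := by
  simp [mean, mul_add, Finset.sum_add_distrib]

lemma mean_sub (P f g : S → ℝ) : mean P (fun s => f s - g s) = mean P f - mean P g := by
  simp [mean, mul_sub, Finset.sum_sub_distrib]

lemma mean_const_mul (P f : S → ℝ) (c : ℝ) : mean P (fun s => c * f s) = c * mean P f := by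
  simp only [mean, Finset.mul_sum]
  exact Finset.sum_congr rfl fun s _ => by ring

lemma mean_const (hp : p ∈ stdSimplex ℝ S) (c : ℝ) : mean p (fun _ => c) = c := by
  simp [mean, ← Finset.sum_mul, hp.2]

lemma mean_mono (hp : p ∈ stdSimplex ℝ S) (h : ∀ s, f s ≤ g s) : mean p f ≤ mean p g :=
  Finset.sum_le_sum fun s _ => mul_le_mul_of_nonneg_left (h s) (hp.1 s)

lemma mean_nonneg (hp : p ∈ stdSimplex ℝ S) (h : ∀ s, 0 ≤ f s) : 0 ≤ mean p f :=
  Finset.sum_nonneg fun s _ => mul_nonneg (hp.1 s) (h s)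

lemma mean_mem_Icc (hp : p ∈ stdSimplex ℝ S) (h : ∀ s, f s ∈ Set.Icc (0 : ℝ) 1) :
    mean p f ∈ Set.Icc (0 : ℝ) 1 :=
  ⟨mean_nonneg hp fun s => (h s).1,
    (mean_mono hp fun s => (h s).2).trans_eq (mean_const hp 1)⟩

lemma variance_nonneg (hp : p ∈ stdSimplex ℝ S) (f : S → ℝ) : 0 ≤ variance p f :=
  Finset.sum_nonneg fun s _ => mul_nonneg (hp.1 s) (sq_nonneg _)

lemma mean_sub_sq (hp : p ∈ stdSimplex ℝ S) (f : S → ℝ) (c : ℝ) :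
    mean p (fun s => (f s - c) ^ 2) = mean p (fun s => f s ^ 2) - 2 * c * mean p f + c ^ 2 := by
  have : (fun s => (f s - c) ^ 2) = fun s => (f s ^ 2 - (2 * c) * f s) + c ^ 2 := by
    funext s; ring
  rw [this, mean_add, mean_sub, mean_const_mul, mean_const hp]

lemma variance_eq (hp : p ∈ stdSimplex ℝ S) (f : S → ℝ) :
    variance p f = mean p (fun s => f s ^ 2) - mean p f ^ 2 := by
  have := mean_sub_sq hp f (mean p f)
  change mean p (fun s => (f s - mean p f) ^ 2) = _
  rw [this]; ring

lemma variance_one_sub (hp : p ∈ stdSimplex ℝ S) (f : S → ℝ) :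
    variance p (fun s => 1 - f s) = variance p f := by
  simp only [variance, mean_sub, mean_const hp]
  exact Finset.sum_congr rfl fun s _ => by ring

/-- The Donsker–Varadhan form of the inequality `KL(q, p) ≤ α`. -/
def DVBound (p q : S → ℝ) (α : ℝ) : Prop :=
  ∀ w : S → ℝ, (∀ s, 0 < w s) →
    mean q (fun s => Real.log (w s)) ≤ α + Real.log (mean p w)

lemma sub_sq_le_log_one_add {y : ℝ} (hy : |y| ≤ 1 / 4) : y - y ^ 2 ≤ Real.log (1 + y) := by
  have h := Real.abs_log_sub_add_sum_range_le (x := -y) (by rw [abs_neg]; linarith) 2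
  rw [abs_neg] at h
  simp only [Finset.sum_range_succ, Finset.sum_range_zero] at h
  norm_num at h
  have h2 : |y| ^ 3 / (1 - |y|) ≤ y ^ 2 / 3 := by
    rw [div_le_iff₀ (by linarith), ← sq_abs y]
    nlinarith [abs_nonneg y, sq_nonneg |y|]
  have h3 := (abs_le.1 h).1
  nlinarith [sq_nonneg y]

/-- An empirical Bernstein inequality. -/
lemma DVBound.mean_sub_le (h : DVBound p q α) (hp : p ∈ stdSimplex ℝ S)
    (hq : q ∈ stdSimplex ℝ S) (hα : 0 < α) (hf : ∀ s, f s ∈ Set.Icc (0 : ℝ) 1) :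
    mean p f - mean q f ≤ max (Real.sqrt (8 * variance q f * α)) (8 * α) := by
  by_contra hcon
  rw [not_le, max_lt_iff] at hcon
  obtain ⟨h1, h2⟩ := hcon
  set m := mean p f with hm
  set d := m - mean q f with hd
  have hd0 : 0 < d := by linarith
  rw [Real.sqrt_lt' hd0] at h1
  have hpm := mean_mem_Icc hp hf
  have hqm := mean_mem_Icc hq hf
  have hd1 : d ≤ 1 := by rw [hd]; linarith [hpm.2, hqm.1]
  -- Test function `1 + l (m - f)`: its `p`-mean is `1`, so the logarithm on the right vanishes. The
  -- choice of `l` makes the linear term `l d = 2 α`, and `d > 8 α` gives `l ≤ 1 / 4`, where `log (1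
  -- + y) ≥ y - y ^ 2`.
  set l := 2 * α / d with hl
  have hl0 : 0 < l := by positivity
  have hl1 : l ≤ 1 / 4 := by rw [hl, div_le_iff₀ hd0]; linarith
  have hld : l * d = 2 * α := by rw [hl]; field_simp
  have habs : ∀ s, |l * (m - f s)| ≤ 1 / 4 := by
    intro s
    rw [abs_mul, abs_of_pos hl0]
    have : |m - f s| ≤ 1 := by
      rw [abs_le]; constructor <;> linarith [hpm.1, hpm.2, (hf s).1, (hf s).2]
    nlinarith [abs_nonneg (m - f s)]
  have key := h (fun s => 1 + l * (m - f s)) (fun s => by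
    have := (abs_le.1 (habs s)).1; linarith)
  have hone : mean p (fun s => 1 + l * (m - f s)) = 1 := by
    rw [mean_add, mean_const_mul, mean_sub, mean_const hp, mean_const hp]; simp [hm]
  rw [hone, Real.log_one, add_zero] at key
  have hlow : l * d - l ^ 2 * (variance q f + d ^ 2) ≤ α := by
    refine le_trans (le_of_eq ?_) ((mean_mono hq fun s => sub_sq_le_log_one_add (habs s)).trans key)
    have e : (fun s => l * (m - f s) - (l * (m - f s)) ^ 2) =
        fun s => l * (m - f s) - l ^ 2 * (f s - m) ^ 2 := by funext s; ring
    rw [e, mean_sub, mean_const_mul, mean_const_mul, mean_sub, mean_const hq, mean_sub_sq hq,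
      variance_eq hq]
    ring
  have e1 : l ^ 2 * (variance q f + d ^ 2) < α := by
    have h3 : l ^ 2 * d ^ 2 = 4 * α ^ 2 := by rw [← mul_pow, hld]; ring
    have h4 : l ^ 2 * (8 * variance q f * α) < 4 * α ^ 2 := by
      rw [← h3]; exact mul_lt_mul_of_pos_left h1 (by positivity)
    have h5 : l ^ 2 * variance q f < α / 2 := by
      refine lt_of_mul_lt_mul_right (a := 8 * α) ?_ (by positivity)
      linarith
    have h6 : 4 * α ^ 2 ≤ α / 2 := by nlinarith
    linarith
  linarith

/-- The other side follows by passing to `1 - f`, which has the same variance. -/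
lemma DVBound.sub_mean_le (h : DVBound p q α) (hp : p ∈ stdSimplex ℝ S)
    (hq : q ∈ stdSimplex ℝ S) (hα : 0 < α) (hf : ∀ s, f s ∈ Set.Icc (0 : ℝ) 1) :
    mean q f - mean p f ≤ max (Real.sqrt (8 * variance q f * α)) (8 * α) := by
  have := h.mean_sub_le hp hq hα (f := fun s => 1 - f s)
    (fun s => ⟨by linarith [(hf s).2], by linarith [(hf s).1]⟩)
  rw [variance_one_sub hq, mean_sub, mean_sub, mean_const hp, mean_const hq] at this
  linarith

/-- Test function `1 + (f - m) ^ 2` with `m` the `p`-mean: `log (1 + y) ≥ y / 2` on `[0, 1]` is used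
under `q`, `log (1 + v) ≤ v` under `p`, and recentring at the `q`-mean only decreases the second
moment. -/
lemma DVBound.variance_le (h : DVBound p q α) (hp : p ∈ stdSimplex ℝ S)
    (hq : q ∈ stdSimplex ℝ S) (hf : ∀ s, f s ∈ Set.Icc (0 : ℝ) 1) :
    variance q f ≤ 2 * variance p f + 2 * α := by
  set m := mean p f with hm
  have hpm := mean_mem_Icc hp hf
  have hg : ∀ s, (f s - m) ^ 2 ≤ 1 := fun s => by
    rw [sq_le_one_iff_abs_le_one, abs_le]
    constructor <;> linarith [hpm.1, hpm.2, (hf s).1, (hf s).2]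
  have key := h (fun s => 1 + (f s - m) ^ 2) (fun s => by positivity)
  have hv := variance_nonneg hp f
  have e1 : mean p (fun s => 1 + (f s - m) ^ 2) = 1 + variance p f := by
    rw [mean_add, mean_const hp]; rfl
  have e2 : Real.log (1 + variance p f) ≤ variance p f := by
    linarith [Real.log_le_sub_one_of_pos (x := 1 + variance p f) (by linarith)]
  have e3 : mean q (fun s => (1 / 2) * (f s - m) ^ 2) ≤
      mean q (fun s => Real.log (1 + (f s - m) ^ 2)) := by
    refine mean_mono hq fun s => le_trans ?_ (Real.one_sub_inv_le_log_of_pos (by positivity))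
    have : 0 ≤ (f s - m) ^ 2 := sq_nonneg _
    have h1 := hg s
    generalize (f s - m) ^ 2 = y at *
    rw [le_sub_iff_add_le, ← le_sub_iff_add_le', inv_le_iff_one_le_mul₀ (by linarith)]
    nlinarith
  rw [mean_const_mul] at e3
  rw [e1] at key
  have e4 : variance q f ≤ mean q (fun s => (f s - m) ^ 2) := by
    rw [mean_sub_sq hq, variance_eq hq]; nlinarith [sq_nonneg (mean q f - m)]
  linarith

/-- Passing from `f` to `g` can lower the variance, but by at most twice the increase `D` of the
mean. The squared root term then drops by at most `16 α D`; since the maximum is at least `8 α`, the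
bonus itself loses no more than `D`. This monotonicity lets optimism propagate backwards. -/
lemma mean_add_bonus_mono (hq : q ∈ stdSimplex ℝ S) (hα : 0 < α)
    (hf : ∀ s, f s ∈ Set.Icc (0 : ℝ) 1) (hg : ∀ s, g s ∈ Set.Icc (0 : ℝ) 1)
    (hfg : ∀ s, f s ≤ g s) :
    mean q f + max (Real.sqrt (8 * variance q f * α)) (8 * α) ≤
      mean q g + max (Real.sqrt (8 * variance q g * α)) (8 * α) := by
  set M := max (Real.sqrt (8 * variance q g * α)) (8 * α) with hM
  have hM1 : 8 * α ≤ M := le_max_right _ _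
  have hM2 : 8 * variance q g * α ≤ M ^ 2 := by
    have := variance_nonneg hq g
    rw [← Real.sqrt_le_left (by linarith)]; exact le_max_left _ _
  have hd : mean q f ≤ mean q g := mean_mono hq hfg
  rw [← le_sub_iff_add_le', max_le_iff]
  refine ⟨?_, by linarith⟩
  by_contra hcon
  rw [not_le] at hcon
  set x := Real.sqrt (8 * variance q f * α)
  have hx : x ^ 2 = 8 * variance q f * α := Real.sq_sqrt (by
    have := variance_nonneg hq f; positivity)
  have hv : variance q f - variance q g ≤ 2 * (mean q g - mean q f) := by
    rw [variance_eq hq, variance_eq hq]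
    have h1 : mean q (fun s => f s ^ 2) ≤ mean q (fun s => g s ^ 2) :=
      mean_mono hq fun s => pow_le_pow_left₀ (hf s).1 (hfg s) 2
    nlinarith [(mean_mem_Icc hq hf).2, (mean_mem_Icc hq hg).2]
  have h3 : x ^ 2 - M ^ 2 ≤ 16 * α * (mean q g - mean q f) := by nlinarith
  nlinarith [sq_nonneg (x - M)]

/-- Split `f = g + (f - g)`; the variance of a `[0, 1]`-valued function is at most its mean. -/
lemma variance_le_two_mul_add (hp : p ∈ stdSimplex ℝ S) (hfg : ∀ s, f s - g s ∈ Set.Icc (0 : ℝ) 1) :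
    variance p f ≤ 2 * variance p g + 2 * mean p (fun s => f s - g s) := by
  have h1 : variance p f ≤ 2 * variance p g + 2 * variance p (fun s => f s - g s) := by
    simp only [variance, Finset.mul_sum, ← Finset.sum_add_distrib]
    refine Finset.sum_le_sum fun s _ => ?_
    rw [mean_sub]
    nlinarith [mul_nonneg (hp.1 s)
      (sq_nonneg ((g s - mean p g) - (f s - g s - (mean p f - mean p g))))]
  have h2 : variance p (fun s => f s - g s) ≤ mean p (fun s => f s - g s) := by
    rw [variance_eq hp]
    have : mean p (fun s => (f s - g s) ^ 2) ≤ mean p (fun s => f s - g s) :=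
      mean_mono hp fun s => by nlinarith [(hfg s).1, (hfg s).2]
    nlinarith [sq_nonneg (mean p fun s => f s - g s)]
  linarith

/-- The upper bound at one stage exceeds the true expectation by at most a Bernstein-type term. -/
lemma DVBound.mean_add_bonus_le (h : DVBound p q α) (hp : p ∈ stdSimplex ℝ S)
    (hq : q ∈ stdSimplex ℝ S) (hα : 0 < α) (hf : ∀ s, f s ∈ Set.Icc (0 : ℝ) 1)
    (hfg : ∀ s, f s - g s ∈ Set.Icc (0 : ℝ) 1) {H : ℝ} (hH : 1 ≤ H) :
    mean q f + max (Real.sqrt (8 * variance q f * α)) (8 * α) ≤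
      mean p f + (12 * Real.sqrt (variance p g * α) + 56 * H * α +
        mean p (fun s => f s - g s) / H) := by
  have h1 := h.sub_mean_le hp hq hα hf
  set Δ := mean p (fun s => f s - g s)
  have hΔ : 0 ≤ Δ := mean_nonneg hp fun s => (hfg s).1
  have hg0 := variance_nonneg hp g
  have h2 : variance q f ≤ 4 * variance p g + 4 * Δ + 2 * α := by
    linarith [h.variance_le hp hq hf, variance_le_two_mul_add hp hfg]
  set y := Real.sqrt (variance p g * α)
  have hy0 : 0 ≤ y := Real.sqrt_nonneg _
  have hy : y ^ 2 = variance p g * α := Real.sq_sqrt (by positivity)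
  -- The cross term `√(Δ α)` is split between `Δ / H` and `H α`. This root enters twice, through the
  -- deviation and through the bonus, so `Δ` ends with coefficient `1 / H`, and the constants become
  -- `12 = 2 · 6` and `56 = 2 · (20 + 8)`.
  have h3 : Real.sqrt (8 * variance q f * α) ≤ 6 * y + 20 * H * α + Δ / (2 * H) := by
    refine Real.sqrt_le_iff.2 ⟨by positivity, ?_⟩
    have h4 : 8 * variance q f * α ≤ 32 * y ^ 2 + 32 * (Δ * α) + 16 * α ^ 2 := by
      rw [hy]; nlinarith
    have h5 : (Δ / (2 * H)) * (H * α) = Δ * α / 2 := by field_simp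
    have h6 : 0 ≤ Δ / (2 * H) := by positivity
    have h7 : α ≤ H * α := by nlinarith
    have h8 : α ^ 2 ≤ (H * α) ^ 2 := pow_le_pow_left₀ hα.le h7 2
    generalize Δ / (2 * H) = z at *
    have h9 : 0 ≤ H * α := by linarith
    have h10 : 20 * H * α = 20 * (H * α) := by ring
    rw [h10]
    generalize H * α = w at *
    have h11 : (6 * y + 20 * w + z) ^ 2 = 36 * y ^ 2 + 400 * w ^ 2 + z ^ 2 + 240 * (y * w) +
      12 * (y * z) + 40 * (z * w) := by ring
    rw [h11, h5]
    nlinarith [sq_nonneg (z - 16 * w), mul_nonneg hy0 h9, mul_nonneg hy0 h6, mul_nonneg h6 h9,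
      sq_nonneg y]
  have h4 : max (Real.sqrt (8 * variance q f * α)) (8 * α) ≤
      Real.sqrt (8 * variance q f * α) + 8 * α :=
    max_le (by linarith) (by linarith [Real.sqrt_nonneg (8 * variance q f * α)])
  have h5 : 2 * (Δ / (2 * H)) = Δ / H := by field_simp
  have h6 : α ≤ H * α := by nlinarith
  nlinarith

end Analysis

/-! ### Marginals of a finite inhomogeneous Markov chain. -/

section MarkovChain

variable {Z : Type*} [Fintype Z]

/-- The probability of the first `n` steps of a Markov chain with initial law `ν` and transition
kernels `K`. -/
def chainProb (ν : Z → ℝ) (K : ℕ → Z → Z → ℝ) (n : ℕ) (x : Fin n → Z) : ℝ :=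
  ∏ i : Fin n, if i.val = 0 then ν (x i) else
    K (i.val - 1) (x ⟨i.val - 1, lt_of_le_of_lt (Nat.sub_le _ _) i.isLt⟩) (x i)

variable {ν : Z → ℝ} {K : ℕ → Z → Z → ℝ}

lemma chainProb_snoc (n : ℕ) (y : Fin (n + 1) → Z) (z : Z) :
    chainProb ν K (n + 2) (Fin.snoc (α := fun _ => Z) y z) =
      chainProb ν K (n + 1) y * K n (y (Fin.last n)) z := by
  unfold chainProb
  rw [Fin.prod_univ_castSucc]
  congr 1
  · refine Finset.prod_congr rfl fun i _ => ?_
    simp only [Fin.val_castSucc, Fin.snoc_castSucc]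
    congr 2
    exact Fin.snoc_castSucc (α := fun _ => Z) z y
      ⟨i.val - 1, lt_of_le_of_lt (Nat.sub_le _ _) i.isLt⟩
  · rw [if_neg (by simp), Fin.snoc_last]
    congr 1
    exact Fin.snoc_castSucc (α := fun _ => Z) z y (Fin.last n)

lemma sum_fin_succ_eq (n : ℕ) (F : (Fin (n + 1) → Z) → ℝ) :
    ∑ x, F x = ∑ y : Fin n → Z, ∑ z : Z, F (Fin.snoc (α := fun _ => Z) y z) := by
  rw [← (Fin.snocEquiv fun _ : Fin (n + 1) => Z).sum_comp, Fintype.sum_prod_type, Finset.sum_comm]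
  rfl

lemma sum_chainProb_succ (n : ℕ) (F : (Fin (n + 2) → Z) → ℝ) :
    ∑ x, chainProb ν K (n + 2) x * F x =
      ∑ y, chainProb ν K (n + 1) y *
        ∑ z, K n (y (Fin.last n)) z * F (Fin.snoc (α := fun _ => Z) y z) := by
  rw [sum_fin_succ_eq]
  refine Finset.sum_congr rfl fun y _ => ?_
  rw [Finset.mul_sum]
  exact Finset.sum_congr rfl fun z _ => by rw [chainProb_snoc, mul_assoc]

/-- The later steps sum out, as rows have total mass one. Only rows before time `n` are constrained,
because `TabularMDP.kernel` is zero beyond the horizon. -/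
lemma sum_chainProb_castLE {m n : ℕ} (hmn : m ≤ n) (hK : ∀ k, k < n → ∀ z, ∑ z', K k z z' = 1)
    (F : (Fin (m + 1) → Z) → ℝ) :
    ∑ x : Fin (n + 1) → Z, chainProb ν K (n + 1) x *
        F (fun i => x (Fin.castLE (Nat.succ_le_succ hmn) i)) =
      ∑ y, chainProb ν K (m + 1) y * F y := by
  induction n, hmn using Nat.le_induction with
  | base => rfl
  | succ n hmn ih =>
    rw [← ih fun k hk => hK k (by omega), sum_chainProb_succ]
    refine Finset.sum_congr rfl fun y _ => ?_
    congr 1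
    have : ∀ z, (fun i : Fin (m + 1) => (Fin.snoc (α := fun _ => Z) y z : Fin (n + 2) → Z)
        (Fin.castLE (by omega) i)) = fun i => y (Fin.castLE (Nat.succ_le_succ hmn) i) :=
      fun z => funext fun i => Fin.snoc_castSucc (α := fun _ => Z) z y
        (Fin.castLE (Nat.succ_le_succ hmn) i)
    simp only [this]
    rw [← Finset.sum_mul, hK n (by omega), one_mul]

/-- The Markov property for consecutive coordinates. -/
lemma sum_chainProb_pair {m n : ℕ} (hmn : m + 1 ≤ n)
    (hK : ∀ k, k < n → ∀ z, ∑ z', K k z z' = 1) (F : Z → Z → ℝ) :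
    ∑ x : Fin (n + 1) → Z, chainProb ν K (n + 1) x *
        F (x ⟨m, by omega⟩) (x ⟨m + 1, by omega⟩) =
      ∑ x : Fin (n + 1) → Z, chainProb ν K (n + 1) x *
        ∑ z', K m (x ⟨m, by omega⟩) z' * F (x ⟨m, by omega⟩) z' := by
  have h1 := sum_chainProb_castLE (ν := ν) hmn hK
    (fun y => F (y ⟨m, by omega⟩) (y ⟨m + 1, by omega⟩))
  have h2 := sum_chainProb_castLE (ν := ν) (m := m) (by omega) hK
    (fun y => ∑ z', K m (y ⟨m, by omega⟩) z' * F (y ⟨m, by omega⟩) z')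
  refine h1.trans (Eq.trans ?_ h2.symm)
  rw [sum_chainProb_succ]
  refine Finset.sum_congr rfl fun y _ => ?_
  congr 1
  refine Finset.sum_congr rfl fun z _ => ?_
  congr 2
  · exact Fin.snoc_castSucc (α := fun _ => Z) z y (Fin.last m)
  · exact Fin.snoc_last (α := fun _ => Z) z y

lemma sum_chainProb_zero (n : ℕ) (hK : ∀ k, k < n → ∀ z, ∑ z', K k z z' = 1) (F : Z → ℝ) :
    ∑ x : Fin (n + 1) → Z, chainProb ν K (n + 1) x * F (x 0) = ∑ z, ν z * F z := by
  have h1 := sum_chainProb_castLE (ν := ν) (Nat.zero_le n) hK (fun y => F (y 0))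
  refine h1.trans ?_
  rw [← (Equiv.funUnique (Fin 1) Z).symm.sum_comp]
  simp [chainProb]

end MarkovChain

/-! ### Occupancy measures, value functions and the law of total variance. -/

section Occupancy

variable {S A : Type*} {H : ℕ} [Fintype S] [Fintype A] [DecidableEq S] [DecidableEq A]
  (M : TabularMDP S A H) (π : Policy S A H)

lemma TabularMDP.p_mem (h : Fin H) (s : S) (a : A) : ⇑(M.p h s a) ∈ stdSimplex ℝ S :=
  (M.p h s a).2

/-- The transition kernel of the Markov chain of state-action pairs under a policy. -/
noncomputable def TabularMDP.kernel (n : ℕ) (z z' : S × A) : ℝ :=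
  if hn : n + 1 < H then
    M.p ⟨n, by omega⟩ z.1 z.2 z'.1 * π ⟨n + 1, hn⟩ z'.1 z'.2
  else 0

lemma TabularMDP.trajProb_eq_chainProb (hH : 0 < H) (x : Trajectory S A H) :
    M.trajProb π x = chainProb
      (fun z => (if z.1 = M.s₁ then 1 else 0) * (π ⟨0, hH⟩ z.1 z.2 : ℝ)) (M.kernel π) H x := by
  refine Finset.prod_congr rfl fun i _ => ?_
  obtain ⟨i, hi⟩ := i
  cases i with
  | zero => simp [TabularMDP.entryProb]
  | succ i => simp [TabularMDP.entryProb, TabularMDP.kernel, hi]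

lemma TabularMDP.sum_kernel_mul {n : ℕ} (hn : n + 1 < H) (z : S × A) (F : S × A → ℝ) :
    ∑ z', M.kernel π n z z' * F z' =
      ∑ s', M.p ⟨n, by omega⟩ z.1 z.2 s' * ∑ a', π ⟨n + 1, hn⟩ s' a' * F (s', a') := by
  simp only [Fintype.sum_prod_type, TabularMDP.kernel, hn, dif_pos, Finset.mul_sum, mul_assoc]

lemma TabularMDP.sum_kernel {n : ℕ} (hn : n + 1 < H) (z : S × A) :
    ∑ z', M.kernel π n z z' = 1 := by
  have := M.sum_kernel_mul π hn z (fun _ => 1)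
  simpa [stdSimplex.sum_eq_one] using this

lemma TabularMDP.entryProb_nonneg (x : Trajectory S A H) (h : Fin H) : 0 ≤ M.entryProb x h := by
  unfold TabularMDP.entryProb
  split_ifs
  · exact zero_le_one
  · exact le_rfl
  · exact (M.p _ _ _).2.1 _

lemma TabularMDP.trajProb_nonneg (x : Trajectory S A H) : 0 ≤ M.trajProb π x :=
  Finset.prod_nonneg fun h _ => mul_nonneg (M.entryProb_nonneg x h) ((π h _).2.1 _)

lemma TabularMDP.sum_trajProb_mul (h : Fin H) (F : S × A → ℝ) :
    ∑ x, M.trajProb π x * F (x h) = ∑ z : S × A, M.occupancy π h z.1 z.2 * F z := by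
  rw [← Finset.sum_fiberwise (s := Finset.univ) (g := fun x : Trajectory S A H => x h)]
  refine Finset.sum_congr rfl fun z _ => ?_
  rw [TabularMDP.occupancy, Finset.sum_mul]
  exact Finset.sum_congr rfl fun x hx => by rw [(Finset.mem_filter.1 hx).2]

lemma TabularMDP.sum_trajProb_pair (h : Fin H) (hh : h.val + 1 < H) (F : S × A → S × A → ℝ) :
    ∑ x, M.trajProb π x * F (x h) (x ⟨h.val + 1, hh⟩) =
      ∑ z : S × A, M.occupancy π h z.1 z.2 *
        ∑ s', M.p h z.1 z.2 s' * ∑ a', π ⟨h.val + 1, hh⟩ s' a' * F z (s', a') := by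
  rw [← M.sum_trajProb_mul π h (fun z => ∑ s', M.p h z.1 z.2 s' *
    ∑ a', π ⟨h.val + 1, hh⟩ s' a' * F z (s', a'))]
  simp only [← M.sum_kernel_mul π hh]
  obtain ⟨n, rfl⟩ : ∃ n, H = n + 1 := ⟨H - 1, by omega⟩
  simp only [M.trajProb_eq_chainProb π (Nat.succ_pos n)]
  exact sum_chainProb_pair (by omega) (fun k hk => M.sum_kernel π (by omega)) F

lemma TabularMDP.sum_trajProb_zero (hH : 0 < H) (F : S × A → ℝ) :
    ∑ x, M.trajProb π x * F (x ⟨0, hH⟩) = ∑ a, π ⟨0, hH⟩ M.s₁ a * F (M.s₁, a) := by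
  obtain ⟨n, rfl⟩ : ∃ n, H = n + 1 := ⟨H - 1, by omega⟩
  simp only [M.trajProb_eq_chainProb π (Nat.succ_pos n)]
  refine (sum_chainProb_zero n (fun k hk => M.sum_kernel π (by omega)) F).trans ?_
  rw [Fintype.sum_prod_type, Finset.sum_eq_single M.s₁ (by intro b _ hb; simp [hb]) (by simp)]
  simp

lemma TabularMDP.sum_trajProb (hH : 0 < H) : ∑ x, M.trajProb π x = 1 := by
  have := M.sum_trajProb_zero π hH (fun _ => 1)
  simpa [stdSimplex.sum_eq_one] using this

lemma TabularMDP.occupancy_nonneg (h : Fin H) (s : S) (a : A) : 0 ≤ M.occupancy π h s a :=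
  Finset.sum_nonneg fun x _ => M.trajProb_nonneg π x

lemma TabularMDP.sum_occupancy (h : Fin H) : ∑ z : S × A, M.occupancy π h z.1 z.2 = 1 := by
  have := M.sum_trajProb_mul π h (fun _ => 1)
  simpa [M.sum_trajProb π h.pos] using this.symm

lemma TabularMDP.occupancy_le_one (h : Fin H) (s : S) (a : A) : M.occupancy π h s a ≤ 1 := by
  rw [← M.sum_occupancy π h]
  exact Finset.single_le_sum (f := fun z : S × A => M.occupancy π h z.1 z.2)
    (fun z _ => M.occupancy_nonneg π h z.1 z.2) (Finset.mem_univ (s, a))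

lemma TabularMDP.sum_occupancy_zero_mul (hH : 0 < H) (F : S × A → ℝ) :
    ∑ z : S × A, M.occupancy π ⟨0, hH⟩ z.1 z.2 * F z = ∑ a, π ⟨0, hH⟩ M.s₁ a * F (M.s₁, a) := by
  rw [← M.sum_trajProb_mul, M.sum_trajProb_zero]

/-- The flow equation: it turns backward recursions in `(s, a)` into recursions in `h` for occupancy
averages. -/
lemma TabularMDP.sum_occupancy_succ_mul (h : Fin H) (hh : h.val + 1 < H) (F : S × A → ℝ) :
    ∑ z : S × A, M.occupancy π ⟨h.val + 1, hh⟩ z.1 z.2 * F z =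
      ∑ z : S × A, M.occupancy π h z.1 z.2 *
        ∑ s', M.p h z.1 z.2 s' * ∑ a', π ⟨h.val + 1, hh⟩ s' a' * F (s', a') := by
  rw [← M.sum_trajProb_mul, M.sum_trajProb_pair π h hh fun _ z => F z]

lemma TabularMDP.value_eq (r : Reward S A H) :
    M.value π r = ∑ h, ∑ z : S × A, M.occupancy π h z.1 z.2 * r h z.1 z.2 := by
  simp only [TabularMDP.value, Fintype.sum_prod_type]

/-- Backward induction; at the last stage the induction hypothesis is vacuous, so the base case is
part of `step`. -/
lemma stage_induction {P : Fin H → Prop} (step : ∀ h, (∀ hh : h.val + 1 < H, P ⟨h.val + 1, hh⟩) → P h)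
    (h : Fin H) : P h := by
  obtain ⟨h, hlt⟩ := h
  induction hk : H - h using Nat.strong_induction_on generalizing h with
  | _ k ih => exact step _ fun hh => ih (H - (h + 1)) (by omega) (h + 1) hh rfl

lemma le_sum_of_stage_le {F e : Fin H → ℝ} (hH : 0 < H)
    (hF : ∀ h : Fin H, F h ≤ e h + if hh : h.val + 1 < H then F ⟨h.val + 1, hh⟩ else 0) :
    F ⟨0, hH⟩ ≤ ∑ h, e h := by
  have key : ∀ h : Fin H, F h ≤ ∑ k ∈ Finset.Ici h, e k := by
    refine stage_induction fun h ih => ?_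
    refine (hF h).trans ?_
    rw [← Finset.Ioi_insert, Finset.sum_insert (by simp)]
    gcongr
    split_ifs with hh
    · refine (ih hh).trans_eq (Finset.sum_congr ?_ fun _ _ => rfl)
      ext k; simp only [Finset.mem_Ici, Finset.mem_Ioi, Fin.le_def, Fin.lt_def]; omega
    · refine (Finset.sum_eq_zero fun k hk => ?_).ge
      have := Fin.lt_def.1 (Finset.mem_Ioi.1 hk); omega
  refine (key _).trans_eq (Finset.sum_congr ?_ fun _ _ => rfl)
  ext k; simp only [Finset.mem_Ici, Fin.le_def, Finset.mem_univ, iff_true]; omega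

/-- Rescaling stage `h` by `c ^ h` reduces this to the additive recursion. -/
lemma le_pow_mul_sum_of_stage_le {F e : Fin H → ℝ} {c : ℝ} (hH : 0 < H) (hc : 1 ≤ c)
    (he : ∀ h, 0 ≤ e h)
    (hF : ∀ h : Fin H, F h ≤ e h + c * if hh : h.val + 1 < H then F ⟨h.val + 1, hh⟩ else 0) :
    F ⟨0, hH⟩ ≤ c ^ H * ∑ h, e h := by
  have h1 := le_sum_of_stage_le (F := fun h => c ^ h.val * F h) (e := fun h => c ^ h.val * e h) hH
    (fun h => by
      refine (mul_le_mul_of_nonneg_left (hF h) (by positivity)).trans_eq ?_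
      rw [mul_add]
      split_ifs
      · ring
      · simp)
  simp only [pow_zero, one_mul] at h1
  refine h1.trans ?_
  rw [Finset.mul_sum]
  exact Finset.sum_le_sum fun h _ =>
    mul_le_mul_of_nonneg_right (pow_le_pow_right₀ hc h.isLt.le) (he h)

/-- The action value `Q_h^π(s, a; r)`. -/
noncomputable def TabularMDP.actionValue (r : Reward S A H) (h : Fin H) (z : S × A) : ℝ :=
  r h z.1 z.2 +
    if hh : h.val + 1 < H then
      ∑ s', M.p h z.1 z.2 s' *
        ∑ a', π ⟨h.val + 1, hh⟩ s' a' * TabularMDP.actionValue r ⟨h.val + 1, hh⟩ (s', a')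
    else 0
termination_by H - h.val

/-- The state value `V_h^π(s; r)`. -/
noncomputable def TabularMDP.stateValue (r : Reward S A H) (h : Fin H) (s : S) : ℝ :=
  ∑ a, π h s a * M.actionValue π r h (s, a)

lemma TabularMDP.actionValue_of_lt (r : Reward S A H) (h : Fin H) (hh : h.val + 1 < H)
    (z : S × A) : M.actionValue π r h z =
      r h z.1 z.2 + mean (M.p h z.1 z.2) (M.stateValue π r ⟨h.val + 1, hh⟩) := by
  rw [TabularMDP.actionValue, dif_pos hh]; rfl

lemma TabularMDP.actionValue_of_not_lt (r : Reward S A H) (h : Fin H) (hh : ¬ h.val + 1 < H)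
    (z : S × A) : M.actionValue π r h z = r h z.1 z.2 := by
  rw [TabularMDP.actionValue, dif_neg hh, add_zero]

lemma TabularMDP.stateValue_le_of_actionValue_le {r : Reward S A H} {h : Fin H} {s : S} {c : ℝ}
    (hc : ∀ a, M.actionValue π r h (s, a) ≤ c) : M.stateValue π r h s ≤ c :=
  (mean_mono (π h s).2 hc).trans_eq (mean_const (π h s).2 c)

lemma TabularMDP.actionValue_nonneg {r : Reward S A H} (hr : r.IsAdmissible) :
    ∀ (h : Fin H) (z : S × A), 0 ≤ M.actionValue π r h z := by
  refine stage_induction fun h ih z => ?_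
  by_cases hh : h.val + 1 < H
  · rw [M.actionValue_of_lt π r h hh]
    exact add_nonneg (hr.1 _ _ _).1
      (mean_nonneg (M.p _ _ _).2 fun s => mean_nonneg (π _ _).2 fun _ => ih hh _)
  · rw [M.actionValue_of_not_lt π r h hh]; exact (hr.1 _ _ _).1

lemma Reward.IsAdmissible.le_sum {r : Reward S A H} (hr : r.IsAdmissible) (h : Fin H) (z : S × A) :
    r h z.1 z.2 ≤ ∑ s, ∑ a, r h s a := by
  rw [← Fintype.sum_prod_type']
  exact Finset.single_le_sum (f := fun z : S × A => r h z.1 z.2) (fun z _ => (hr.1 _ _ _).1)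
    (Finset.mem_univ z)

lemma TabularMDP.actionValue_le_one {r : Reward S A H} (hr : r.IsAdmissible) (h : Fin H)
    (z : S × A) : M.actionValue π r h z ≤ 1 := by
  -- The bound `1` does not pass through the recursion; the remaining reward mass from stage `h` on
  -- does.
  have key : ∀ (h : Fin H) (z : S × A),
      M.actionValue π r h z ≤ ∑ k ∈ Finset.Ici h, ∑ s, ∑ a, r k s a := by
    refine stage_induction fun h ih z => ?_
    rw [← Finset.Ioi_insert, Finset.sum_insert (by simp)]
    by_cases hh : h.val + 1 < H
    · rw [M.actionValue_of_lt π r h hh]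
      refine add_le_add (hr.le_sum h z) ?_
      have e : Finset.Ioi h = Finset.Ici ⟨h.val + 1, hh⟩ := by
        ext k; simp only [Finset.mem_Ici, Finset.mem_Ioi, Fin.le_def, Fin.lt_def]; omega
      rw [e]
      refine (mean_mono (M.p _ _ _).2 fun s =>
        M.stateValue_le_of_actionValue_le π fun a => ih hh _).trans_eq (mean_const (M.p _ _ _).2 _)
    · rw [M.actionValue_of_not_lt π r h hh]
      exact le_add_of_le_of_nonneg (hr.le_sum h z) (Finset.sum_nonneg fun k _ =>
        Finset.sum_nonneg fun s _ => Finset.sum_nonneg fun a _ => (hr.1 _ _ _).1)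
  refine (key h z).trans (le_trans ?_ hr.2)
  exact Finset.sum_le_sum_of_subset_of_nonneg (Finset.subset_univ _) fun k _ _ =>
    Finset.sum_nonneg fun s _ => Finset.sum_nonneg fun a _ => (hr.1 _ _ _).1

lemma TabularMDP.stateValue_mem_Icc {r : Reward S A H} (hr : r.IsAdmissible) (h : Fin H) (s : S) :
    M.stateValue π r h s ∈ Set.Icc (0 : ℝ) 1 :=
  mean_mem_Icc (π h s).2 fun _ => ⟨M.actionValue_nonneg π hr h _, M.actionValue_le_one π hr h _⟩

lemma TabularMDP.value_eq_stateValue (hH : 0 < H) (r : Reward S A H) :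
    M.value π r = M.stateValue π r ⟨0, hH⟩ M.s₁ := by
  have step : ∀ h : Fin H, ∑ z : S × A, M.occupancy π h z.1 z.2 * M.actionValue π r h z =
      ∑ z : S × A, M.occupancy π h z.1 z.2 * r h z.1 z.2 + if hh : h.val + 1 < H then
        ∑ z : S × A, M.occupancy π ⟨h.val + 1, hh⟩ z.1 z.2 *
          M.actionValue π r ⟨h.val + 1, hh⟩ z else 0 := by
    intro h
    split_ifs with hh
    · rw [M.sum_occupancy_succ_mul π h hh, ← Finset.sum_add_distrib]
      refine Finset.sum_congr rfl fun z _ => ?_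
      rw [M.actionValue_of_lt π r h hh, mul_add]; rfl
    · simp only [M.actionValue_of_not_lt π r h hh, add_zero]
  have e0 := M.sum_occupancy_zero_mul π hH (M.actionValue π r ⟨0, hH⟩)
  rw [M.value_eq]
  change _ = ∑ a, _
  rw [← e0]
  refine le_antisymm ?_ (le_sum_of_stage_le
    (F := fun h => ∑ z : S × A, M.occupancy π h z.1 z.2 * M.actionValue π r h z) hH
    fun h => (step h).le)
  -- The telescoping lemma is one-sided; applied to the negated quantities it gives the reverse
  -- inequality.
  have := le_sum_of_stage_le
    (F := fun h => -∑ z : S × A, M.occupancy π h z.1 z.2 * M.actionValue π r h z)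
    (e := fun h => -∑ z : S × A, M.occupancy π h z.1 z.2 * r h z.1 z.2) hH
    fun h => by
      rw [step h]; split_ifs <;> simp
  rw [Finset.sum_neg_distrib] at this
  linarith

lemma DetPolicy.sum_toPolicy_mul (π : DetPolicy S A H) (h : Fin H) (s : S) (F : A → ℝ) :
    ∑ a, π.toPolicy h s a * F a = F (π h s) := by
  simp [DetPolicy.toPolicy, Pi.single_apply]

lemma TabularMDP.stateValue_toPolicy (π : DetPolicy S A H) (r : Reward S A H) (h : Fin H) (s : S) :
    M.stateValue π.toPolicy r h s = M.actionValue π.toPolicy r h (s, π h s) :=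
  DetPolicy.sum_toPolicy_mul π h s _

/-- The variance of the value of the next state, with value zero at the last stage. -/
noncomputable def TabularMDP.nextVariance (r : Reward S A H) (h : Fin H) (z : S × A) : ℝ :=
  if hh : h.val + 1 < H then
    variance (M.p h z.1 z.2) (M.stateValue π r ⟨h.val + 1, hh⟩) else 0

lemma TabularMDP.nextVariance_nonneg (r : Reward S A H) (h : Fin H) (z : S × A) :
    0 ≤ M.nextVariance π r h z := by
  unfold TabularMDP.nextVariance
  split_ifs
  · exact variance_nonneg (M.p _ _ _).2 _
  · exact le_rfl

/-- A version of the law of total variance. -/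
lemma TabularMDP.sum_nextVariance_le (π : DetPolicy S A H) {r : Reward S A H}
    (hr : r.IsAdmissible) :
    ∑ h, ∑ z : S × A, M.occupancy π.toPolicy h z.1 z.2 * M.nextVariance π.toPolicy r h z ≤
      2 * M.value π.toPolicy r := by
  rcases Nat.eq_zero_or_pos H with rfl | hH
  · simp [TabularMDP.value]
  set ρ := π.toPolicy with hρ
  -- Telescope the occupancy average of `Q ^ 2`. For a deterministic policy the next state value is
  -- an action value, so the drop of `Q ^ 2` plus the variance is `Q ^ 2 - (Q - r) ^ 2 = 2 r Q - r ^
  -- 2`, at most `2 r` because `Q ≤ 1`.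
  have key := le_sum_of_stage_le hH
    (F := fun h => ∑ z : S × A, M.occupancy ρ h z.1 z.2 * M.actionValue ρ r h z ^ 2)
    (e := fun h => 2 * ∑ z : S × A, M.occupancy ρ h z.1 z.2 * r h z.1 z.2 -
      ∑ z : S × A, M.occupancy ρ h z.1 z.2 * M.nextVariance ρ r h z) ?_
  · have h0 : 0 ≤ ∑ z : S × A, M.occupancy ρ ⟨0, hH⟩ z.1 z.2 * M.actionValue ρ r ⟨0, hH⟩ z ^ 2 :=
      Finset.sum_nonneg fun z _ => mul_nonneg (M.occupancy_nonneg ρ _ _ _) (sq_nonneg _)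
    rw [Finset.sum_sub_distrib, ← Finset.mul_sum, ← M.value_eq] at key
    linarith
  · intro h
    split_ifs with hh
    · rw [M.sum_occupancy_succ_mul ρ h hh, Finset.mul_sum, ← Finset.sum_sub_distrib,
        ← Finset.sum_add_distrib]
      refine Finset.sum_le_sum fun z _ => ?_
      simp only [hρ, DetPolicy.sum_toPolicy_mul]
      simp only [← hρ]
      have e1 : M.nextVariance ρ r h z = mean (M.p h z.1 z.2)
          (fun s => M.actionValue ρ r ⟨h.val + 1, hh⟩ (s, π ⟨h.val + 1, hh⟩ s) ^ 2) -
          (M.actionValue ρ r h z - r h z.1 z.2) ^ 2 := by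
        rw [TabularMDP.nextVariance, dif_pos hh, variance_eq (M.p_mem h z.1 z.2),
          M.actionValue_of_lt ρ r h hh]
        simp only [hρ, M.stateValue_toPolicy, add_sub_cancel_left]
      change _ ≤ _ + _ * mean (M.p h z.1 z.2)
          (fun s => M.actionValue ρ r ⟨h.val + 1, hh⟩ (s, π ⟨h.val + 1, hh⟩ s) ^ 2)
      have h1 := M.occupancy_nonneg ρ h z.1 z.2
      have h2 := M.actionValue_le_one ρ hr h z
      have h3 := (hr.1 h z.1 z.2).1
      rw [e1]
      have h4 := mul_nonneg h1 (mul_nonneg h3 (sub_nonneg.2 h2))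
      have h5 := mul_nonneg h1 (sq_nonneg (r h z.1 z.2))
      nlinarith
    · rw [add_zero, Finset.mul_sum, ← Finset.sum_sub_distrib]
      refine Finset.sum_le_sum fun z _ => ?_
      rw [M.actionValue_of_not_lt ρ r h hh, TabularMDP.nextVariance, dif_neg hh]
      have h1 := M.occupancy_nonneg ρ h z.1 z.2
      have h3 := (hr.1 h z.1 z.2)
      have h4 := mul_nonneg h1 (mul_nonneg h3.1 (sub_nonneg.2 h3.2))
      have h5 := mul_nonneg h1 h3.1
      nlinarith

end Occupancy

/-! ### Optimism and the regret bound on the concentration event. -/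

section Regret

variable {S A : Type*} {H : ℕ} [Fintype S] [Fintype A] [DecidableEq S] [DecidableEq A]

lemma sum_transitions (X : ℕ → Trajectory S A H) (t : ℕ) (h : Fin H) (hh : h.val + 1 < H)
    (s : S) (a : A) : ∑ s', transitions X t h hh s a s' = visits X t h s a := by
  unfold transitions visits
  rw [Finset.card_eq_sum_card_fiberwise (f := fun j => (X j ⟨h.val + 1, hh⟩).1)
    (t := Finset.univ) (fun _ _ => Finset.mem_coe.2 (Finset.mem_univ _))]
  simp only [Finset.filter_filter]

lemma visits_le (X : ℕ → Trajectory S A H) (t : ℕ) (h : Fin H) (s : S) (a : A) :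
    visits X t h s a ≤ t :=
  (Finset.card_filter_le _ _).trans_eq (Finset.card_range t)

lemma empTransition_mem {X : ℕ → Trajectory S A H} {t : ℕ} {h : Fin H} (hh : h.val + 1 < H)
    {s : S} {a : A} (hv : visits X t h s a ≠ 0) :
    empTransition X t h hh s a ∈ stdSimplex ℝ S := by
  refine ⟨fun s' => by unfold empTransition; positivity, ?_⟩
  simp only [empTransition]
  rw [← Finset.sum_div, ← Nat.cast_sum, sum_transitions, div_self (Nat.cast_ne_zero.2 hv)]

variable (S A H) in
/-- The quantity `log (2 S A H / δ)`. -/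
noncomputable def logTerm (δ : ℝ) : ℝ := Real.log (2 * Fintype.card S * Fintype.card A * H / δ)

lemma two_le_card_div [Nonempty S] [Nonempty A] (hH : 0 < H) {δ : ℝ} (hδ₀ : 0 < δ) (hδ₁ : δ < 1) :
    2 ≤ 2 * Fintype.card S * Fintype.card A * H / δ := by
  rw [le_div_iff₀ hδ₀]
  have h1 : (1 : ℝ) ≤ Fintype.card S * Fintype.card A * H := by
    exact_mod_cast Nat.mul_pos (Nat.mul_pos Fintype.card_pos Fintype.card_pos) hH
  nlinarith

lemma logTerm_nonneg [Nonempty S] [Nonempty A] (hH : 0 < H) {δ : ℝ} (hδ₀ : 0 < δ) (hδ₁ : δ < 1) :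
    0 ≤ logTerm S A H δ :=
  Real.log_nonneg (by linarith [two_le_card_div (S := S) (A := A) hH hδ₀ hδ₁])

lemma log_eight_exp_mul {x : ℝ} (hx : 0 < x) :
    Real.log (8 * Real.exp 1 * x) = 3 * Real.log 2 + 1 + Real.log x := by
  rw [Real.log_mul (by positivity) hx.ne', Real.log_mul (by norm_num) (Real.exp_pos 1).ne',
    Real.log_exp, show (8 : ℝ) = 2 ^ 3 by norm_num, Real.log_pow]
  norm_num

lemma beta_eq (δ : ℝ) (n : ℕ) : beta S A H δ n = logTerm S A H δ +
    Fintype.card S * (3 * Real.log 2 + 1 + Real.log (n + 1)) := by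
  rw [beta, log_eight_exp_mul (by positivity)]; rfl

lemma logTerm_add_one_le_beta [Nonempty S] (δ : ℝ) (n : ℕ) :
    logTerm S A H δ + 1 ≤ beta S A H δ n := by
  rw [beta_eq]
  have h1 : (1 : ℝ) ≤ Fintype.card S := by exact_mod_cast Fintype.card_pos
  have h2 : 0 ≤ Real.log (n + 1 : ℝ) := Real.log_nonneg (by linarith [n.cast_nonneg (α := ℝ)])
  nlinarith [Real.log_nonneg (x := 2) (by norm_num)]

lemma beta_mono (δ : ℝ) {m n : ℕ} (hmn : m ≤ n) : beta S A H δ m ≤ beta S A H δ n := by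
  rw [beta_eq, beta_eq]
  gcongr

lemma bonus_eq (δ : ℝ) (n : ℕ) (P V : S → ℝ) : bonus A H δ n P V =
    max (Real.sqrt (8 * variance P V * (beta S A H δ n / n))) (8 * (beta S A H δ n / n)) := by
  rw [bonus, mul_div_assoc, mul_div_assoc]

variable [Nonempty A] (M : TabularMDP S A H) (δ : ℝ) (X : ℕ → Trajectory S A H)

/-- The upper confidence bound `V̄_h^t(s; r) = max_a Q̄_h^t(s, a; r)`. -/
noncomputable def upperV (t : ℕ) (r : Reward S A H) (h : Fin H) (s : S) : ℝ :=
  Finset.univ.sup' Finset.univ_nonempty fun a => upperQ δ X t r h s a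

lemma upperQ_of_not_lt (t : ℕ) (r : Reward S A H) {h : Fin H} (hh : ¬ h.val + 1 < H) (s : S)
    (a : A) : upperQ δ X t r h s a = r h s a := by
  rw [upperQ, dif_neg hh]

lemma upperQ_of_visits_eq_zero (t : ℕ) (r : Reward S A H) {h : Fin H} (hh : h.val + 1 < H) {s : S}
    {a : A} (hv : visits X t h s a = 0) : upperQ δ X t r h s a = 1 := by
  rw [upperQ, dif_pos hh, if_pos hv]

lemma upperQ_of_visits_ne_zero (t : ℕ) (r : Reward S A H) {h : Fin H} (hh : h.val + 1 < H) {s : S}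
    {a : A} (hv : visits X t h s a ≠ 0) : upperQ δ X t r h s a =
      min (r h s a + mean (empTransition X t h hh s a) (upperV δ X t r ⟨h.val + 1, hh⟩) +
        bonus A H δ (visits X t h s a) (empTransition X t h hh s a)
          (upperV δ X t r ⟨h.val + 1, hh⟩)) 1 := by
  rw [upperQ, dif_pos hh, if_neg hv]; rfl

lemma upperQ_le_upperV (t : ℕ) (r : Reward S A H) (h : Fin H) (s : S) (a : A) :
    upperQ δ X t r h s a ≤ upperV δ X t r h s :=
  Finset.le_sup' (fun a => upperQ δ X t r h s a) (Finset.mem_univ a)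

lemma upperV_mem_Icc_of_upperQ {t : ℕ} {r : Reward S A H} {h : Fin H} {s : S}
    (hQ : ∀ a, upperQ δ X t r h s a ∈ Set.Icc (0 : ℝ) 1) :
    upperV δ X t r h s ∈ Set.Icc (0 : ℝ) 1 :=
  ⟨(hQ (Classical.arbitrary A)).1.trans (upperQ_le_upperV δ X t r h s _),
    Finset.sup'_le _ _ fun a _ => (hQ a).2⟩

lemma bonus_nonneg (n : ℕ) (P V : S → ℝ) : 0 ≤ bonus A H δ n P V :=
  le_max_of_le_left (Real.sqrt_nonneg _)

lemma upperQ_mem_Icc (t : ℕ) {r : Reward S A H} (hr : r.IsAdmissible) :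
    ∀ (h : Fin H) (s : S) (a : A), upperQ δ X t r h s a ∈ Set.Icc (0 : ℝ) 1 := by
  refine stage_induction fun h ih s a => ?_
  by_cases hh : h.val + 1 < H
  · by_cases hv : visits X t h s a = 0
    · rw [upperQ_of_visits_eq_zero δ X t r hh hv]; simp
    · rw [upperQ_of_visits_ne_zero δ X t r hh hv]
      refine ⟨le_min (add_nonneg (add_nonneg (hr.1 _ _ _).1 (mean_nonneg (empTransition_mem hh hv)
        fun s' => (upperV_mem_Icc_of_upperQ δ X (ih hh s')).1)) (bonus_nonneg δ _ _ _)) zero_le_one,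
        min_le_right _ _⟩
  · rw [upperQ_of_not_lt δ X t r hh]; exact hr.1 _ _ _

lemma upperV_mem_Icc (t : ℕ) {r : Reward S A H} (hr : r.IsAdmissible) (h : Fin H) (s : S) :
    upperV δ X t r h s ∈ Set.Icc (0 : ℝ) 1 :=
  upperV_mem_Icc_of_upperQ δ X (upperQ_mem_Icc δ X t hr h s)

/-- The event that all empirical transition probabilities are accurate. -/
def TransitionsConcentrate : Prop :=
  ∀ t h (hh : h.val + 1 < H) s a, visits X t h s a ≠ 0 →
    DVBound (M.p h s a) (empTransition X t h hh s a)
      (beta S A H δ (visits X t h s a) / visits X t h s a)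

/-- The event that the numbers of visits are not much smaller than their conditional means. -/
def VisitsConcentrate (π : ℕ → DetPolicy S A H) : Prop :=
  ∀ t h s a, (∑ j ∈ Finset.range t, M.occupancy (π j).toPolicy h s a) / 2 - logTerm S A H δ ≤
    visits X t h s a

variable {M δ X}

lemma beta_div_pos [Nonempty S] (hδ₀ : 0 < δ) (hδ₁ : δ < 1) (hH : 0 < H) {n : ℕ} (hn : n ≠ 0) :
    0 < beta S A H δ n / n :=
  div_pos (by linarith [logTerm_nonneg (S := S) (A := A) hH hδ₀ hδ₁,
    logTerm_add_one_le_beta (S := S) (A := A) (H := H) δ n]) (by positivity)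

/-- Optimism: the upper confidence bounds dominate the values of all policies. -/
lemma TransitionsConcentrate.actionValue_le (hc : TransitionsConcentrate M δ X) (hδ₀ : 0 < δ)
    (hδ₁ : δ < 1) (t : ℕ) {r : Reward S A H} (hr : r.IsAdmissible) (π : Policy S A H) :
    ∀ (h : Fin H) (s : S) (a : A), M.actionValue π r h (s, a) ≤ upperQ δ X t r h s a := by
  have : Nonempty S := ⟨M.s₁⟩
  refine stage_induction fun h ih s a => ?_
  by_cases hh : h.val + 1 < H
  · by_cases hv : visits X t h s a = 0
    · rw [upperQ_of_visits_eq_zero δ X t r hh hv]; exact M.actionValue_le_one π hr h _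
    · rw [upperQ_of_visits_ne_zero δ X t r hh hv]
      refine le_min ?_ (M.actionValue_le_one π hr h _)
      have hα := beta_div_pos (S := S) (A := A) hδ₀ hδ₁ h.pos hv
      rw [M.actionValue_of_lt π r h hh, add_assoc, bonus_eq]
      refine add_le_add le_rfl ?_
      -- Bernstein is applied to the true value function, with its own variance; monotonicity of
      -- mean plus bonus then replaces that function by the larger upper bound used by the
      -- algorithm.
      have h1 := (hc t h hh s a hv).mean_sub_le (M.p_mem h s a) (empTransition_mem hh hv) hα
        (M.stateValue_mem_Icc π hr ⟨h.val + 1, hh⟩)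
      have h2 := mean_add_bonus_mono (empTransition_mem hh hv) hα
        (M.stateValue_mem_Icc π hr ⟨h.val + 1, hh⟩) (upperV_mem_Icc δ X t hr ⟨h.val + 1, hh⟩)
        (fun s' => M.stateValue_le_of_actionValue_le π fun a' =>
          (ih hh s' a').trans (upperQ_le_upperV δ X t r _ s' a'))
      dsimp only at *
      linarith
  · rw [upperQ_of_not_lt δ X t r hh, M.actionValue_of_not_lt π r h hh]

lemma TransitionsConcentrate.stateValue_le (hc : TransitionsConcentrate M δ X) (hδ₀ : 0 < δ)
    (hδ₁ : δ < 1) (t : ℕ) {r : Reward S A H} (hr : r.IsAdmissible) (π : Policy S A H)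
    (h : Fin H) (s : S) : M.stateValue π r h s ≤ upperV δ X t r h s :=
  M.stateValue_le_of_actionValue_le π fun a =>
    (hc.actionValue_le hδ₀ hδ₁ t hr π h s a).trans (upperQ_le_upperV δ X t r h s a)

lemma TransitionsConcentrate.optValue_le (hc : TransitionsConcentrate M δ X) (hδ₀ : 0 < δ)
    (hδ₁ : δ < 1) (t : ℕ) {r : Reward S A H} (hr : r.IsAdmissible) (hH : 0 < H) :
    M.optValue r ≤ upperV δ X t r ⟨0, hH⟩ M.s₁ := by
  have : Nonempty (Policy S A H) := ⟨fun _ _ => stdSimplex.vertex (Classical.arbitrary A)⟩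
  refine ciSup_le fun π => ?_
  rw [M.value_eq_stateValue π hH]
  exact hc.stateValue_le hδ₀ hδ₁ t hr π _ _

variable (δ X) in
/-- The width `min (β(n, δ) / n) 1` of the confidence region, where `n = n_h^t(s, a)`. -/
noncomputable def confWidth (t : ℕ) (h : Fin H) (z : S × A) : ℝ :=
  if visits X t h z.1 z.2 = 0 then 1 else
    min (beta S A H δ (visits X t h z.1 z.2) / visits X t h z.1 z.2) 1

lemma confWidth_nonneg [Nonempty S] (hδ₀ : 0 < δ) (hδ₁ : δ < 1) (t : ℕ) (h : Fin H) (z : S × A) :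
    0 ≤ confWidth δ X t h z := by
  unfold confWidth
  split_ifs with hv
  · exact zero_le_one
  · exact le_min (beta_div_pos hδ₀ hδ₁ h.pos hv).le zero_le_one

lemma upperV_eq_of_greedy {t : ℕ} {r : Reward S A H} {π : DetPolicy S A H}
    (hπ : ∀ h s a, upperQ δ X t r h s a ≤ upperQ δ X t r h s (π h s)) (h : Fin H) (s : S) :
    upperV δ X t r h s = upperQ δ X t r h s (π h s) :=
  le_antisymm (Finset.sup'_le _ _ fun a _ => hπ h s a) (upperQ_le_upperV δ X t r h s _)

/-- The recursive bound for the gap between the upper confidence bound and the true value of the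
greedy policy. -/
lemma TransitionsConcentrate.upperQ_sub_le (hc : TransitionsConcentrate M δ X) (hδ₀ : 0 < δ)
    (hδ₁ : δ < 1) (t : ℕ) {r : Reward S A H} (hr : r.IsAdmissible) (π : Policy S A H)
    (h : Fin H) (z : S × A) :
    upperQ δ X t r h z.1 z.2 - M.actionValue π r h z ≤
      12 * Real.sqrt (M.nextVariance π r h z * confWidth δ X t h z) +
        56 * H * confWidth δ X t h z + (1 + 1 / (H : ℝ)) * if hh : h.val + 1 < H then
          mean (M.p h z.1 z.2) (fun s' => upperV δ X t r ⟨h.val + 1, hh⟩ s' -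
            M.stateValue π r ⟨h.val + 1, hh⟩ s') else 0 := by
  have : Nonempty S := ⟨M.s₁⟩
  have hH1 : (1 : ℝ) ≤ H := by exact_mod_cast h.pos
  have hw := confWidth_nonneg (X := X) hδ₀ hδ₁ t h z
  by_cases hh : h.val + 1 < H
  · rw [dif_pos hh]
    have hΔ : ∀ s', upperV δ X t r ⟨h.val + 1, hh⟩ s' - M.stateValue π r ⟨h.val + 1, hh⟩ s' ∈
        Set.Icc (0 : ℝ) 1 := fun s' =>
      ⟨sub_nonneg.2 (hc.stateValue_le hδ₀ hδ₁ t hr π _ s'), by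
        linarith [(upperV_mem_Icc δ X t hr ⟨h.val + 1, hh⟩ s').2,
          (M.stateValue_mem_Icc π hr ⟨h.val + 1, hh⟩ s').1]⟩
    have hΔ0 := mean_nonneg (M.p_mem h z.1 z.2) fun s' => (hΔ s').1
    -- At width `1` the term `56 H` alone exceeds the gap, which is at most `1`.
    by_cases hw1 : confWidth δ X t h z = 1
    · rw [hw1]
      have h1 := (upperQ_mem_Icc δ X t hr h z.1 z.2).2
      have h2 := M.actionValue_nonneg π hr h z
      have h3 := Real.sqrt_nonneg (M.nextVariance π r h z * 1)
      have h4 : 0 ≤ (1 + 1 / (H : ℝ)) * mean (M.p h z.1 z.2) (fun s' =>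
        upperV δ X t r ⟨h.val + 1, hh⟩ s' - M.stateValue π r ⟨h.val + 1, hh⟩ s') := by positivity
      linarith
    · have hv : visits X t h z.1 z.2 ≠ 0 := fun hv => hw1 (by rw [confWidth, if_pos hv])
      have hwe : confWidth δ X t h z =
          beta S A H δ (visits X t h z.1 z.2) / visits X t h z.1 z.2 := by
        rw [confWidth, if_neg hv] at hw1 ⊢
        exact min_eq_left (le_of_not_ge fun hge => hw1 (min_eq_right hge))
      have key := (hc t h hh z.1 z.2 hv).mean_add_bonus_le (M.p_mem h z.1 z.2)
        (empTransition_mem hh hv) (beta_div_pos hδ₀ hδ₁ h.pos hv)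
        (upperV_mem_Icc δ X t hr ⟨h.val + 1, hh⟩) hΔ hH1
      rw [← bonus_eq, ← hwe] at key
      have h1 := min_le_left (r h z.1 z.2 + mean (empTransition X t h hh z.1 z.2)
        (upperV δ X t r ⟨h.val + 1, hh⟩) + bonus A H δ (visits X t h z.1 z.2)
          (empTransition X t h hh z.1 z.2) (upperV δ X t r ⟨h.val + 1, hh⟩)) 1
      rw [← upperQ_of_visits_ne_zero δ X t r hh hv] at h1
      have h2 := M.actionValue_of_lt π r h hh z
      rw [TabularMDP.nextVariance, dif_pos hh, add_mul, one_mul, one_div_mul_eq_div, mean_sub]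
      rw [mean_sub] at key
      linarith
  · rw [dif_neg hh, upperQ_of_not_lt δ X t r hh, M.actionValue_of_not_lt π r h hh, sub_self]
    positivity

lemma one_add_inv_pow_le_three {n : ℕ} (hn : 0 < n) : (1 + 1 / (n : ℝ)) ^ n ≤ 3 := by
  have hn' : (0 : ℝ) < n := by exact_mod_cast hn
  calc (1 + 1 / (n : ℝ)) ^ n ≤ Real.exp (1 / n) ^ n :=
        pow_le_pow_left₀ (by positivity) (by linarith [Real.add_one_le_exp (1 / (n : ℝ))]) n
    _ = Real.exp 1 := by rw [← Real.exp_nat_mul, mul_one_div_cancel hn'.ne']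
    _ ≤ 3 := by linarith [Real.exp_one_lt_d9]

/-- The regret of one episode. -/
lemma TransitionsConcentrate.optValue_sub_value_le (hc : TransitionsConcentrate M δ X)
    (hδ₀ : 0 < δ) (hδ₁ : δ < 1) (t : ℕ) {r : Reward S A H} (hr : r.IsAdmissible)
    {π : DetPolicy S A H} (hH : 0 < H)
    (hπ : ∀ h s a, upperQ δ X t r h s a ≤ upperQ δ X t r h s (π h s)) :
    M.optValue r - M.value π.toPolicy r ≤ ∑ h, ∑ z : S × A, M.occupancy π.toPolicy h z.1 z.2 *
      (36 * Real.sqrt (M.nextVariance π.toPolicy r h z * confWidth δ X t h z) +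
        168 * H * confWidth δ X t h z) := by
  have : Nonempty S := ⟨M.s₁⟩
  have hw := confWidth_nonneg (X := X) hδ₀ hδ₁ t
  set ρ := π.toPolicy with hρ
  have hocc := M.occupancy_nonneg ρ
  have he : ∀ h : Fin H, 0 ≤ ∑ z : S × A, M.occupancy ρ h z.1 z.2 *
      (12 * Real.sqrt (M.nextVariance ρ r h z * confWidth δ X t h z) +
        56 * H * confWidth δ X t h z) := fun h => Finset.sum_nonneg fun z _ =>
    mul_nonneg (hocc _ _ _) (add_nonneg (by positivity) (mul_nonneg (by positivity) (hw h z)))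
  -- Greediness identifies the next upper state value with the upper action value at the played
  -- action, so the recursion closes in the occupancy average of the gap. Its growth factor `(1 + 1
  -- / H) ^ H ≤ 3` turns `12` and `56` into `36` and `168`.
  have key := le_pow_mul_sum_of_stage_le (c := 1 + 1 / (H : ℝ)) hH
    (by linarith [show 0 ≤ 1 / (H : ℝ) by positivity]) he
    (F := fun h => ∑ z : S × A, M.occupancy ρ h z.1 z.2 *
      (upperQ δ X t r h z.1 z.2 - M.actionValue ρ r h z)) (fun h => by
      split_ifs with hh
      · rw [M.sum_occupancy_succ_mul ρ h hh, Finset.mul_sum, ← Finset.sum_add_distrib]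
        refine Finset.sum_le_sum fun z _ => ?_
        have h1 := mul_le_mul_of_nonneg_left (hc.upperQ_sub_le hδ₀ hδ₁ t hr ρ h z) (hocc h z.1 z.2)
        rw [dif_pos hh] at h1
        refine h1.trans_eq ?_
        simp only [upperV_eq_of_greedy hπ, hρ, M.stateValue_toPolicy, DetPolicy.sum_toPolicy_mul,
          mean]
        ring
      · rw [mul_zero, add_zero]
        refine Finset.sum_le_sum fun z _ => ?_
        have h1 := mul_le_mul_of_nonneg_left (hc.upperQ_sub_le hδ₀ hδ₁ t hr ρ h z) (hocc h z.1 z.2)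
        rwa [dif_neg hh, mul_zero, add_zero] at h1)
  have e0 : ∑ z : S × A, M.occupancy ρ ⟨0, hH⟩ z.1 z.2 *
      (upperQ δ X t r ⟨0, hH⟩ z.1 z.2 - M.actionValue ρ r ⟨0, hH⟩ z) =
      upperV δ X t r ⟨0, hH⟩ M.s₁ - M.value ρ r := by
    rw [M.sum_occupancy_zero_mul ρ hH, M.value_eq_stateValue ρ hH, upperV_eq_of_greedy hπ]
    simp only [hρ, M.stateValue_toPolicy, DetPolicy.sum_toPolicy_mul]
  have h0 := hc.optValue_le hδ₀ hδ₁ t hr hH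
  have h2 := (e0.symm.le.trans key).trans
    (mul_le_mul_of_nonneg_right (one_add_inv_pow_le_three hH) (Finset.sum_nonneg fun h _ => he h))
  refine (sub_le_sub_right h0 _).trans (h2.trans_eq ?_)
  simp only [Finset.mul_sum]
  exact Finset.sum_congr rfl fun h _ => Finset.sum_congr rfl fun z _ => by ring

/-- With `x = u / (U + 1)`, the left side is at most `2 x` and `log (1 + x) ≥ x / 2` on `[0, 1]`.
The right side telescopes when summed over episodes. -/
lemma div_max_one_le {U u : ℝ} (hU : 0 ≤ U) (hu : 0 ≤ u) (hu1 : u ≤ 1) :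
    u / max U 1 ≤ 4 * (Real.log (U + u + 1) - Real.log (U + 1)) := by
  rw [← Real.log_div (by positivity) (by positivity)]
  set x := u / (U + 1) with hx
  have hx0 : 0 ≤ x := by positivity
  have hx1 : x ≤ 1 := by rw [hx, div_le_one (by positivity)]; linarith
  have e : (U + u + 1) / (U + 1) = 1 + x := by rw [hx]; field_simp; ring
  rw [e]
  have h1 : u / max U 1 ≤ 2 * x := by
    rw [hx, ← mul_div_assoc, div_le_div_iff₀ (by positivity) (by positivity)]
    have : U + 1 ≤ 2 * max U 1 := by linarith [le_max_left U 1, le_max_right U 1]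
    nlinarith
  have h2 : x / 2 ≤ Real.log (1 + x) := by
    refine le_trans ?_ (Real.one_sub_inv_le_log_of_pos (by positivity))
    rw [le_sub_iff_add_le, ← le_sub_iff_add_le', inv_le_iff_one_le_mul₀ (by positivity)]
    nlinarith
  linarith

lemma sum_div_max_one_le {u : ℕ → ℝ} (hu : ∀ t, 0 ≤ u t) (hu1 : ∀ t, u t ≤ 1) (T : ℕ) :
    ∑ t ∈ Finset.range T, u t / max (∑ j ∈ Finset.range t, u j) 1 ≤ 4 * Real.log (T + 1) := by
  have h1 : ∑ t ∈ Finset.range T, u t / max (∑ j ∈ Finset.range t, u j) 1 ≤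
      4 * Real.log ((∑ j ∈ Finset.range T, u j) + 1) := by
    induction T with
    | zero => simp
    | succ T ih =>
      rw [Finset.sum_range_succ, Finset.sum_range_succ (fun j => u j)]
      linarith [div_max_one_le (Finset.sum_nonneg fun j (_ : j ∈ Finset.range T) => hu j)
        (hu T) (hu1 T)]
  have h2 : ∑ j ∈ Finset.range T, u j ≤ T := by
    simpa using Finset.sum_le_card_nsmul (Finset.range T) u 1 fun j _ => hu1 j
  have h3 : 0 ≤ ∑ j ∈ Finset.range T, u j := Finset.sum_nonneg fun j _ => hu j
  refine h1.trans ?_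
  gcongr

/-- Random counts are traded for cumulated occupancies `U`. If `U ≤ 4 * logTerm S A H δ`, the right
side is at least `1` and the width at most `1`; otherwise the number of visits is at least `U / 4`.
-/
lemma VisitsConcentrate.confWidth_le {π : ℕ → DetPolicy S A H} (hv : VisitsConcentrate M δ X π)
    (hδ₀ : 0 < δ) (hδ₁ : δ < 1) {t T : ℕ} (htT : t ≤ T) (h : Fin H) (z : S × A) :
    confWidth δ X t h z ≤ 4 * beta S A H δ T /
      max (∑ j ∈ Finset.range t, M.occupancy (π j).toPolicy h z.1 z.2) 1 := by
  have : Nonempty S := ⟨M.s₁⟩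
  have h1 := hv t h z.1 z.2
  set U := ∑ j ∈ Finset.range t, M.occupancy (π j).toPolicy h z.1 z.2
  have hl := logTerm_nonneg (S := S) (A := A) h.pos hδ₀ hδ₁
  have hb := logTerm_add_one_le_beta (S := S) (A := A) (H := H) δ T
  have hm : 0 < max U 1 := by positivity
  have triv : U ≤ 4 * logTerm S A H δ → 1 ≤ 4 * beta S A H δ T / max U 1 := fun hU => by
    rw [one_le_div hm]; exact max_le (by linarith) (by linarith)
  unfold confWidth
  split_ifs with hn
  · rw [hn] at h1
    exact triv (by push_cast at h1; linarith)
  · by_cases hU : U ≤ 4 * logTerm S A H δ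
    · exact (min_le_right _ _).trans (triv hU)
    · refine (min_le_left _ _).trans ?_
      have hn1 : (1 : ℝ) ≤ visits X t h z.1 z.2 := by exact_mod_cast Nat.one_le_iff_ne_zero.2 hn
      rw [div_le_div_iff₀ (by linarith) hm]
      have h2 := beta_mono (S := S) (A := A) (H := H) δ ((visits_le X t h z.1 z.2).trans htT)
      have h3 : max U 1 ≤ 4 * visits X t h z.1 z.2 := max_le (by linarith) (by linarith)
      calc _ ≤ beta S A H δ T * (4 * visits X t h z.1 z.2) :=
            mul_le_mul h2 h3 hm.le (by linarith)
        _ = _ := by ring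

lemma VisitsConcentrate.sum_confWidth_le {π : ℕ → DetPolicy S A H}
    (hv : VisitsConcentrate M δ X π) (hδ₀ : 0 < δ) (hδ₁ : δ < 1) (T : ℕ) (h : Fin H) (z : S × A) :
    ∑ t ∈ Finset.range T, M.occupancy (π t).toPolicy h z.1 z.2 * confWidth δ X t h z ≤
      25 * logFactor S A H δ T := by
  have : Nonempty S := ⟨M.s₁⟩
  have hl := logTerm_nonneg (S := S) (A := A) h.pos hδ₀ hδ₁
  have hb := logTerm_add_one_le_beta (S := S) (A := A) (H := H) δ T
  have h1 : ∑ t ∈ Finset.range T, M.occupancy (π t).toPolicy h z.1 z.2 * confWidth δ X t h z ≤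
      4 * beta S A H δ T * (4 * Real.log (T + 1)) := by
    refine le_trans ?_ (mul_le_mul_of_nonneg_left (sum_div_max_one_le
      (u := fun t => M.occupancy (π t).toPolicy h z.1 z.2)
      (fun t => M.occupancy_nonneg _ _ _ _) (fun t => M.occupancy_le_one _ _ _ _) T) (by linarith))
    rw [Finset.mul_sum]
    refine Finset.sum_le_sum fun t ht => ?_
    refine (mul_le_mul_of_nonneg_left (hv.confWidth_le hδ₀ hδ₁ (Finset.mem_range.1 ht).le h z)
      (M.occupancy_nonneg _ _ _ _)).trans_eq ?_
    ring
  refine h1.trans ?_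
  rcases Nat.eq_zero_or_pos T with rfl | hT
  · simp [logFactor]
  have hlog2 : Real.log 2 ≤ Real.log (T + 1) :=
    Real.log_le_log (by norm_num) (by
      have : (1 : ℝ) ≤ T := by exact_mod_cast hT
      linarith)
  have hlog := Real.log_two_gt_d9
  have hS : (0 : ℝ) ≤ Fintype.card S := Nat.cast_nonneg _
  rw [beta_eq, logFactor]
  change _ ≤ 25 * ((logTerm S A H δ + 6 * Fintype.card S) * Real.log (T + 1) ^ 2)
  generalize Real.log (T + 1) = y at *
  -- Here `y = log (T + 1) ≥ log 2`, which gives both `16 ≤ 25 y` and `16 (3 log 2 + 1 + y) ≤ 150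
  -- y`; this fixes the constant `25`.
  have h2 : 16 * (logTerm S A H δ + Fintype.card S * (3 * Real.log 2 + 1 + y)) ≤
      25 * (logTerm S A H δ + 6 * Fintype.card S) * y := by
    have h3 : 16 * logTerm S A H δ ≤ 25 * logTerm S A H δ * y := by nlinarith
    have h4 : Fintype.card S * (16 * (3 * Real.log 2 + 1 + y)) ≤ Fintype.card S * (150 * y) :=
      mul_le_mul_of_nonneg_left (by linarith) hS
    linarith
  nlinarith

/-- Cauchy–Schwarz with weights `o`. -/
lemma sum_mul_sqrt_le {ι : Type*} {I : Finset ι} {o v w : ι → ℝ} {b c : ℝ} (ho : ∀ i, 0 ≤ o i)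
    (hv : ∀ i, 0 ≤ v i) (hw : ∀ i, 0 ≤ w i) (hb : ∑ i ∈ I, o i * v i ≤ b)
    (hc : ∑ i ∈ I, o i * w i ≤ c) :
    ∑ i ∈ I, o i * Real.sqrt (v i * w i) ≤ Real.sqrt (b * c) := by
  have hov : ∀ i, 0 ≤ o i * v i := fun i => mul_nonneg (ho i) (hv i)
  have how : ∀ i, 0 ≤ o i * w i := fun i => mul_nonneg (ho i) (hw i)
  have key := Real.sum_sqrt_mul_sqrt_le I hov how
  rw [Real.sqrt_mul ((Finset.sum_nonneg fun i _ => hov i).trans hb)]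
  refine le_trans (Finset.sum_le_sum fun i _ => le_of_eq ?_) (key.trans (mul_le_mul
    (Real.sqrt_le_sqrt hb) (Real.sqrt_le_sqrt hc) (Real.sqrt_nonneg _) (Real.sqrt_nonneg _)))
  rw [← Real.sqrt_mul (hov i), mul_mul_mul_comm, Real.sqrt_mul (mul_self_nonneg _),
    Real.sqrt_mul_self (ho i)]

lemma sum_le_of_le_sum_mul_sqrt {ι : Type*} [Fintype ι] {T : ℕ} {o v w : ℕ → ι → ℝ} {x : ℕ → ℝ}
    {b c d e : ℝ} (hd : 0 ≤ d) (he : 0 ≤ e) (ho : ∀ t i, 0 ≤ o t i) (hv : ∀ t i, 0 ≤ v t i)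
    (hw : ∀ t i, 0 ≤ w t i)
    (hx : ∀ t, x t ≤ ∑ i, o t i * (d * Real.sqrt (v t i * w t i) + e * w t i))
    (hb : ∑ t ∈ Finset.range T, ∑ i, o t i * v t i ≤ b)
    (hc : ∑ t ∈ Finset.range T, ∑ i, o t i * w t i ≤ c) :
    ∑ t ∈ Finset.range T, x t ≤ d * Real.sqrt (b * c) + e * c := by
  rw [← Finset.sum_product'] at hb hc
  have key := sum_mul_sqrt_le (fun i : ℕ × ι => ho i.1 i.2) (fun i => hv i.1 i.2)
    (fun i => hw i.1 i.2) hb hc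
  refine (Finset.sum_le_sum fun t _ => hx t).trans ?_
  rw [← Finset.sum_product' (f := fun t i => o t i * (d * Real.sqrt (v t i * w t i) + e * w t i))]
  refine le_trans (le_of_eq ?_)
    (add_le_add (mul_le_mul_of_nonneg_left key hd) (mul_le_mul_of_nonneg_left hc he))
  rw [Finset.mul_sum, Finset.mul_sum, ← Finset.sum_add_distrib]
  exact Finset.sum_congr rfl fun i _ => by ring

/-- The regret bound on the event that the transitions and the visits concentrate. -/
lemma TransitionsConcentrate.regret_le (hc : TransitionsConcentrate M δ X)
    {π : ℕ → DetPolicy S A H} (hv : VisitsConcentrate M δ X π) (hδ₀ : 0 < δ) (hδ₁ : δ < 1)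
    (hH : 0 < H) {r : ℕ → Reward S A H} (hr : ∀ t, (r t).IsAdmissible)
    (hπ : ∀ t h s a, upperQ δ X t (r t) h s a ≤ upperQ δ X t (r t) h s (π t h s)) (T : ℕ) :
    ∑ t ∈ Finset.range T, (M.optValue (r t) - M.value (π t).toPolicy (r t)) ≤
      5140 * Fintype.card S * Fintype.card A * H ^ 2 * logFactor S A H δ T +
        256 * Real.sqrt (Fintype.card S * Fintype.card A * H * logFactor S A H δ T *
          ∑ t ∈ Finset.range T, M.value (π t).toPolicy (r t)) := by
  have : Nonempty S := ⟨M.s₁⟩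
  have e1 : 5140 * (Fintype.card S : ℝ) * Fintype.card A * H ^ 2 * logFactor S A H δ T =
      5140 * (H * (Fintype.card S * Fintype.card A * H * logFactor S A H δ T)) := by ring
  rw [e1]
  have hYK : ∑ t ∈ Finset.range T, ∑ i : Fin H × S × A,
      M.occupancy (π t).toPolicy i.1 i.2.1 i.2.2 * confWidth δ X t i.1 i.2 ≤
      25 * (Fintype.card S * Fintype.card A * H * logFactor S A H δ T) := by
    rw [Finset.sum_comm]
    refine (Finset.sum_le_sum fun i _ => hv.sum_confWidth_le hδ₀ hδ₁ T i.1 i.2).trans_eq ?_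
    simp
    ring
  have hVG : ∑ t ∈ Finset.range T, ∑ i : Fin H × S × A,
      M.occupancy (π t).toPolicy i.1 i.2.1 i.2.2 *
        M.nextVariance (π t).toPolicy (r t) i.1 i.2 ≤
      2 * ∑ t ∈ Finset.range T, M.value (π t).toPolicy (r t) := by
    rw [Finset.mul_sum]
    refine Finset.sum_le_sum fun t _ => ?_
    rw [Fintype.sum_prod_type]
    exact M.sum_nextVariance_le (π t) (hr t)
  have hreg := sum_le_of_le_sum_mul_sqrt (d := 36) (e := 168 * H)
    (x := fun t => M.optValue (r t) - M.value (π t).toPolicy (r t)) (by norm_num) (by positivity)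
    (fun t (i : Fin H × S × A) => M.occupancy_nonneg (π t).toPolicy i.1 i.2.1 i.2.2)
    (fun t i => M.nextVariance_nonneg (π t).toPolicy (r t) i.1 i.2)
    (fun t i => confWidth_nonneg (X := X) hδ₀ hδ₁ t i.1 i.2)
    (fun t => by
      rw [Fintype.sum_prod_type]
      exact hc.optValue_sub_value_le hδ₀ hδ₁ t (hr t) hH (hπ t)) hVG hYK
  have hY0 : 0 ≤ ∑ t ∈ Finset.range T, ∑ i : Fin H × S × A,
      M.occupancy (π t).toPolicy i.1 i.2.1 i.2.2 * confWidth δ X t i.1 i.2 :=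
    Finset.sum_nonneg fun t _ => Finset.sum_nonneg fun i _ =>
      mul_nonneg (M.occupancy_nonneg _ _ _ _) (confWidth_nonneg hδ₀ hδ₁ t i.1 i.2)
  have hK0 := hY0.trans hYK
  generalize (Fintype.card S * Fintype.card A * H * logFactor S A H δ T : ℝ) = K at *
  generalize ∑ t ∈ Finset.range T, M.value (π t).toPolicy (r t) = G at *
  -- `36 √50 < 256`; the remaining term costs `168 · 25 = 4200`, below `5140`.
  have hs : 36 * Real.sqrt (2 * G * (25 * K)) ≤ 256 * Real.sqrt (K * G) := by
    rw [show 2 * G * (25 * K) = 50 * (K * G) by ring, Real.sqrt_mul (by norm_num)]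
    have : Real.sqrt 50 ≤ 256 / 36 := Real.sqrt_le_iff.2 ⟨by norm_num, by norm_num⟩
    nlinarith [Real.sqrt_nonneg (K * G)]
  have h6 : 0 ≤ H * K := mul_nonneg (Nat.cast_nonneg _) (by linarith)
  linarith

end Regret

/-! ### Laplace's rule of succession and the Donsker–Varadhan bound. -/

section Likelihood

/-- Divided by `n!`, the left side counts the vectors of `k` visit counts with sum `n`. This
polynomial factor is the price of Laplace's rule against the best law in hindsight. -/
lemma ascFactorial_le (k n : ℕ) : k.ascFactorial n ≤ n.factorial * (n + 1) ^ k := by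
  induction k with
  | zero => cases n <;> simp [Nat.zero_ascFactorial]
  | succ k ih =>
    rcases Nat.eq_zero_or_pos k with rfl | hk
    · simp only [zero_add, Nat.one_ascFactorial, pow_one]
      exact Nat.le_mul_of_pos_right _ (Nat.succ_pos n)
    · refine Nat.le_of_mul_le_mul_left ?_ hk
      rw [Nat.succ_ascFactorial]
      calc (k + n) * k.ascFactorial n ≤ (k * (n + 1)) * (n.factorial * (n + 1) ^ k) :=
            Nat.mul_le_mul (by nlinarith) ih
        _ = _ := by ring

/-- The probability of a class of sequences under a product law is at most `1`. -/
lemma factorial_mul_prod_pow_le {S : Type*} [Fintype S] [DecidableEq S] {q : S → ℝ}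
    (hq : q ∈ stdSimplex ℝ S) (k : S → ℕ) :
    ((∑ s, k s).factorial : ℝ) * ∏ s, q s ^ k s ≤ ∏ s, ((k s).factorial : ℝ) := by
  have h1 := Finset.sum_pow_eq_sum_piAntidiag Finset.univ q (∑ s, k s)
  rw [hq.2, one_pow] at h1
  have h2 : (Nat.multinomial Finset.univ k : ℝ) * ∏ s, q s ^ k s ≤ 1 := by
    rw [h1]
    exact Finset.single_le_sum
      (f := fun k : S → ℕ => (Nat.multinomial Finset.univ k : ℝ) * ∏ s, q s ^ k s)
      (fun k _ => mul_nonneg (Nat.cast_nonneg _)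
        (Finset.prod_nonneg fun s _ => pow_nonneg (hq.1 s) _)) (by simp)
  have h3 : (∏ s, ((k s).factorial : ℝ)) * Nat.multinomial Finset.univ k =
      (∑ s, k s).factorial := by
    exact_mod_cast Nat.multinomial_spec Finset.univ k
  rw [← h3, mul_assoc]
  exact mul_le_of_le_one_right (Finset.prod_nonneg fun s _ => Nat.cast_nonneg _) h2

/-- A likelihood bound that is uniform over all laws implies the Donsker–Varadhan bound for the
empirical law. -/
lemma sum_mul_log_le_of_prod_pow_le {S : Type*} [Fintype S] {p : S → ℝ}
    (hp : p ∈ stdSimplex ℝ S) {k : S → ℕ} {C : ℝ} (hC : 0 < C) (hpk : 0 < ∏ s, p s ^ k s)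
    (h : ∀ q ∈ stdSimplex ℝ S, ∏ s, q s ^ k s ≤ C * ∏ s, p s ^ k s)
    {w : S → ℝ} (hw : ∀ s, 0 < w s) :
    ∑ s, k s * Real.log (w s) ≤ Real.log C + (∑ s, k s : ℕ) * Real.log (mean p w) := by
  have hm : 0 < mean p w := by
    refine lt_of_le_of_ne (mean_nonneg hp fun s => (hw s).le) fun h0 => ?_
    have h1 := (Finset.sum_eq_zero_iff_of_nonneg fun s _ => mul_nonneg (hp.1 s) (hw s).le).1 h0.symm
    have h2 : ∑ s, p s = 0 := Finset.sum_eq_zero fun s hs =>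
      (mul_eq_zero.1 (h1 s hs)).resolve_right (hw s).ne'
    rw [hp.2] at h2
    exact one_ne_zero h2
  -- Choose for `q` the tilt of `p` by `w`; the factor `∏ p ^ k` then cancels.
  have h1 := h (fun s => p s * w s / mean p w) ⟨fun s =>
    div_nonneg (mul_nonneg (hp.1 s) (hw s).le) hm.le, by
      rw [← Finset.sum_div]; exact div_self hm.ne'⟩
  simp only [div_pow, mul_pow, Finset.prod_div_distrib, Finset.prod_mul_distrib,
    Finset.prod_pow_eq_pow_sum] at h1
  rw [div_le_iff₀ (by positivity)] at h1
  have h2 : ∏ s, w s ^ k s ≤ C * mean p w ^ ∑ s, k s := by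
    refine le_of_mul_le_mul_left ?_ hpk
    linarith
  have hw' : ∀ s, w s ^ k s ≠ 0 := fun s => (pow_pos (hw s) _).ne'
  have h3 := Real.log_le_log (Finset.prod_pos fun s _ => pow_pos (hw s) _) h2
  rw [Real.log_prod fun s _ => hw' s, Real.log_mul hC.ne' (by positivity), Real.log_pow] at h3
  simpa only [Real.log_pow] using h3

variable {S A : Type*} {H : ℕ} [Fintype S] [Fintype A] [DecidableEq S] [DecidableEq A]

lemma visits_succ (X : ℕ → Trajectory S A H) (t : ℕ) (h : Fin H) (s : S) (a : A) :
    visits X (t + 1) h s a = visits X t h s a + if X t h = (s, a) then 1 else 0 := by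
  simp only [visits, Finset.card_filter, Finset.sum_range_succ]

lemma transitions_succ (X : ℕ → Trajectory S A H) (t : ℕ) (h : Fin H) (hh : h.val + 1 < H)
    (s : S) (a : A) (s' : S) :
    transitions X (t + 1) h hh s a s' = transitions X t h hh s a s' +
      if X t h = (s, a) ∧ (X t ⟨h.val + 1, hh⟩).1 = s' then 1 else 0 := by
  simp only [transitions, Finset.card_filter, Finset.sum_range_succ]

variable (M : TabularMDP S A H)

/-- The likelihood ratio of the transition at stage `h` of the trajectory `x` between Laplace's
rule of succession, fitted to the first `t` trajectories of `X`, and the true transition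
probabilities. It is `1` unless `(s, a)` is visited at stage `h`. -/
noncomputable def laplaceRatio (h : Fin H) (hh : h.val + 1 < H) (s : S) (a : A)
    (X : ℕ → Trajectory S A H) (t : ℕ) (x : Trajectory S A H) : ℝ :=
  if x h = (s, a) then
    ((transitions X t h hh s a (x ⟨h.val + 1, hh⟩).1 + 1 : ℕ) : ℝ) /
      (visits X t h s a + Fintype.card S : ℕ) / M.p h s a (x ⟨h.val + 1, hh⟩).1
  else 1

lemma laplaceRatio_nonneg (h : Fin H) (hh : h.val + 1 < H) (s : S) (a : A)
    (X : ℕ → Trajectory S A H) (t : ℕ) (x : Trajectory S A H) :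
    0 ≤ laplaceRatio M h hh s a X t x := by
  unfold laplaceRatio
  split_ifs
  · exact div_nonneg (by positivity) ((M.p_mem h s a).1 _)
  · exact zero_le_one

/-- Given a visit, the mean of the ratio is the mass that Laplace's rule puts on the support of the
true law. States outside this support contribute zero, so the running products form a
supermartingale, perhaps not a martingale. -/
lemma sum_trajProb_mul_laplaceRatio_le (π : Policy S A H) (h : Fin H) (hh : h.val + 1 < H)
    (s : S) (a : A) (X : ℕ → Trajectory S A H) (t : ℕ) :
    ∑ x, M.trajProb π x * laplaceRatio M h hh s a X t x ≤ 1 := by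
  have : Nonempty S := ⟨M.s₁⟩
  refine (M.sum_trajProb_pair π h hh fun z z' => if z = (s, a) then
    ((transitions X t h hh s a z'.1 + 1 : ℕ) : ℝ) /
      (visits X t h s a + Fintype.card S : ℕ) / M.p h s a z'.1 else 1).le.trans ?_
  refine le_trans (Finset.sum_le_sum fun z _ =>
    mul_le_of_le_one_right (M.occupancy_nonneg π h _ _) ?_) (M.sum_occupancy π h).le
  simp only [← Finset.sum_mul, stdSimplex.sum_eq_one, one_mul]
  split_ifs with hz
  · subst hz
    have h1 : ∀ s', M.p h s a s' * (((transitions X t h hh s a s' + 1 : ℕ) : ℝ) /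
        (visits X t h s a + Fintype.card S : ℕ) / M.p h s a s') ≤
        ((transitions X t h hh s a s' + 1 : ℕ) : ℝ) / (visits X t h s a + Fintype.card S : ℕ) := by
      intro s'
      rcases ((M.p_mem h s a).1 s').eq_or_lt with h0 | h0
      · rw [← h0, zero_mul]; positivity
      · rw [mul_div_cancel₀ _ h0.ne']
    refine (Finset.sum_le_sum fun s' _ => h1 s').trans ?_
    rw [← Finset.sum_div, ← Nat.cast_sum, Finset.sum_add_distrib, sum_transitions]
    simp only [Finset.sum_const, Finset.card_univ, smul_eq_mul, mul_one]
    exact div_self_le_one _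
  · exact (mean_const (M.p_mem h z.1 z.2) 1).le

/-- Multiplying the sequential predictions gives `∏ k! / (S (S + 1) ⋯ (S + n - 1))`, regardless of
order. Positivity of the observed transitions ensures that the denominators in the ratios really
cancel. -/
lemma prod_laplaceRatio (h : Fin H) (hh : h.val + 1 < H) (s : S) (a : A)
    (X : ℕ → Trajectory S A H)
    (hX : ∀ t, X t h = (s, a) → 0 < M.p h s a (X t ⟨h.val + 1, hh⟩).1) (t : ℕ) :
    (∏ j ∈ Finset.range t, laplaceRatio M h hh s a X j (X j)) *
        (∏ s', M.p h s a s' ^ transitions X t h hh s a s') *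
        ((Fintype.card S).ascFactorial (visits X t h s a) : ℝ) =
      ∏ s', ((transitions X t h hh s a s').factorial : ℝ) := by
  have : Nonempty S := ⟨M.s₁⟩
  induction t with
  | zero => simp [transitions, visits]
  | succ t ih =>
    rw [Finset.prod_range_succ]
    simp only [transitions_succ, visits_succ]
    by_cases hx : X t h = (s, a)
    · have hp := hX t hx
      rw [laplaceRatio, if_pos hx]
      simp only [hx, true_and, if_true]
      set s₀ := (X t ⟨h.val + 1, hh⟩).1
      have e1 : ∀ s', (((transitions X t h hh s a s' + if s₀ = s' then 1 else 0).factorial : ℕ) : ℝ) =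
          (transitions X t h hh s a s').factorial *
            if s₀ = s' then ((transitions X t h hh s a s' + 1 : ℕ) : ℝ) else 1 := by
        intro s'
        split_ifs
        · rw [Nat.factorial_succ]; push_cast; ring
        · simp
      simp only [e1, pow_add, Finset.prod_mul_distrib, ← ih, Nat.ascFactorial_succ]
      have e2 : ∏ s', M.p h s a s' ^ (if s₀ = s' then 1 else 0) = M.p h s a s₀ := by
        simp
      rw [e2, Finset.prod_ite_eq]
      simp only [Finset.mem_univ, if_true]
      have hn : ((visits X t h s a + Fintype.card S : ℕ) : ℝ) ≠ 0 :=
        Nat.cast_ne_zero.2 (by have := Fintype.card_pos (α := S); omega)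
      rw [Nat.add_comm (Fintype.card S)]
      have hp' := hp.ne'
      push_cast at hn ⊢
      field_simp
    · simp only [hx, false_and, if_false, add_zero, laplaceRatio, mul_one]
      exact ih

/-- If the likelihood ratios remain below `2 S A H / δ`, the empirical transition probabilities
satisfy the Donsker–Varadhan bound. -/
lemma dvBound_of_prod_laplaceRatio_lt [Nonempty A] {δ : ℝ} (hδ₀ : 0 < δ) (hδ₁ : δ < 1) (h : Fin H)
    (hh : h.val + 1 < H) (s : S) (a : A) (X : ℕ → Trajectory S A H)
    (hX : ∀ t, X t h = (s, a) → 0 < M.p h s a (X t ⟨h.val + 1, hh⟩).1) (t : ℕ)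
    (ht : ∏ j ∈ Finset.range t, laplaceRatio M h hh s a X j (X j) <
      2 * Fintype.card S * Fintype.card A * H / δ) (hv : visits X t h s a ≠ 0) :
    DVBound (M.p h s a) (empTransition X t h hh s a)
      (beta S A H δ (visits X t h s a) / visits X t h s a) := by
  have : Nonempty S := ⟨M.s₁⟩
  intro w hw
  have hp := M.p_mem h s a
  have hsum := sum_transitions X t h hh s a
  set n := visits X t h s a with hn
  have hn0 : (0 : ℝ) < n := by positivity
  set k := transitions X t h hh s a with hk
  set c : ℝ := 2 * Fintype.card S * Fintype.card A * H / δ with hc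
  have hc0 : 0 < c := by linarith [two_le_card_div (S := S) (A := A) h.pos hδ₀ hδ₁]
  have hprod := prod_laplaceRatio M h hh s a X hX t
  rw [← hn, ← hk] at hprod
  have hfac : (0 : ℝ) < ∏ s', ((k s').factorial : ℝ) :=
    Finset.prod_pos fun s' _ => by exact_mod_cast (k s').factorial_pos
  have hpk : 0 < ∏ s', M.p h s a s' ^ k s' := by
    refine lt_of_le_of_ne (Finset.prod_nonneg fun s' _ => pow_nonneg (hp.1 s') _) fun h0 => ?_
    rw [← h0, mul_zero, zero_mul] at hprod
    exact hfac.ne hprod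
  -- For any law `q`, `n! ∏ q ^ k ≤ ∏ k!`, and by `prod_laplaceRatio` the right side is the ratio
  -- times `∏ p ^ k` times the rising factorial. The ratio is below `c`, and the rising factorial at
  -- most `n! (n + 1) ^ S`.
  have key := sum_mul_log_le_of_prod_pow_le hp (k := k)
    (C := c * (n + 1 : ℝ) ^ Fintype.card S) (by positivity) hpk (fun q hq => by
      have h1 := factorial_mul_prod_pow_le hq k
      rw [hsum] at h1
      have h2 : ((Fintype.card S).ascFactorial n : ℝ) ≤
          n.factorial * (n + 1 : ℝ) ^ Fintype.card S := by
        exact_mod_cast ascFactorial_le (Fintype.card S) n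
      have hf : (0 : ℝ) < n.factorial := by exact_mod_cast n.factorial_pos
      refine le_of_mul_le_mul_left (h1.trans ?_) hf
      rw [← hprod]
      calc _ ≤ c * (∏ s', M.p h s a s' ^ k s') *
            (n.factorial * (n + 1 : ℝ) ^ Fintype.card S) := by gcongr
        _ = _ := by ring) hw
  rw [hsum, Real.log_mul hc0.ne' (by positivity), Real.log_pow] at key
  have hbeta : Real.log c + Fintype.card S * Real.log (n + 1) ≤ beta S A H δ n := by
    rw [beta_eq, logTerm, ← hc]
    have := Real.log_nonneg (x := 2) (by norm_num)
    have h2 : (0 : ℝ) ≤ Fintype.card S := Nat.cast_nonneg _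
    nlinarith
  have e : mean (empTransition X t h hh s a) (fun s' => Real.log (w s')) =
      (∑ s', k s' * Real.log (w s')) / n := by
    rw [mean, Finset.sum_div]
    exact Finset.sum_congr rfl fun s' _ => by rw [empTransition, ← hn, ← hk]; ring
  rw [e, div_add' _ _ _ hn0.ne', div_le_div_iff_of_pos_right hn0]
  linarith

end Likelihood

/-! ### Supermartingales along the run and the probability of the concentration event. -/

section Probability

open scoped ENNReal

variable {Ω : Type*} {mΩ : MeasurableSpace Ω} {μ : Measure Ω} {ℱ : Filtration ℕ mΩ}

/-- Ville's maximal inequality for nonnegative supermartingales. -/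
lemma mul_measure_exists_le_le_one {W : ℕ → Ω → ℝ≥0∞} (hW : ∀ t, Measurable[ℱ t] (W t))
    (h0 : ∫⁻ ω, W 0 ω ∂μ ≤ 1)
    (hstep : ∀ t B, MeasurableSet[ℱ t] B → ∫⁻ ω in B, W (t + 1) ω ∂μ ≤ ∫⁻ ω in B, W t ω ∂μ)
    (c : ℝ≥0∞) : c * μ {ω | ∃ t, c ≤ W t ω} ≤ 1 := by
  have hD : ∀ t, MeasurableSet[ℱ t] {ω | c ≤ W t ω} := fun t =>
    hW t (measurableSet_Ici (a := c))
  have hB : ∀ t, MeasurableSet[ℱ t] {ω | ∃ j ≤ t, c ≤ W j ω} := fun t => by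
    have : {ω | ∃ j ≤ t, c ≤ W j ω} = ⋃ j ∈ Set.Iic t, {ω | c ≤ W j ω} := by ext; simp
    rw [this]
    exact MeasurableSet.biUnion (Set.to_countable _) fun j hj => ℱ.mono hj _ (hD j)
  have low : ∀ (t : ℕ) (E : Set Ω), MeasurableSet E → E ⊆ {ω | c ≤ W t ω} →
      c * μ E ≤ ∫⁻ ω in E, W t ω ∂μ := fun t E hE hsub => by
    rw [← setLIntegral_const]
    exact setLIntegral_mono' hE fun ω hω => hsub hω
  -- Stopping at the first crossing: mass that has crossed is frozen at level `c`, the rest still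
  -- carries `W t`, and this total stays at most `1`.
  have key : ∀ t, c * μ {ω | ∃ j ≤ t, c ≤ W j ω} +
      ∫⁻ ω in {ω | ∃ j ≤ t, c ≤ W j ω}ᶜ, W t ω ∂μ ≤ 1 := by
    intro t
    induction t with
    | zero =>
      refine le_trans (add_le_add (low 0 _ (ℱ.le 0 _ (hB 0)) ?_) le_rfl)
        ((lintegral_add_compl _ (ℱ.le 0 _ (hB 0))).le.trans h0)
      rintro ω ⟨j, hj, h⟩
      obtain rfl := Nat.le_zero.1 hj
      exact h
    | succ t ih =>
      set B := {ω | ∃ j ≤ t, c ≤ W j ω} with hBdef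
      set D := {ω | c ≤ W (t + 1) ω} with hDdef
      have hBt : MeasurableSet B := ℱ.le t _ (hB t)
      have hDt : MeasurableSet D := ℱ.le _ _ (hD (t + 1))
      have e1 : {ω | ∃ j ≤ t + 1, c ≤ W j ω} = B ∪ (Bᶜ ∩ D) := by
        ext ω
        simp only [hBdef, hDdef, Set.mem_ofPred_eq, Set.mem_union, Set.mem_inter_iff,
          Set.mem_compl_iff]
        constructor
        · rintro ⟨j, hj, h⟩
          by_cases hb : ∃ j ≤ t, c ≤ W j ω
          · exact Or.inl hb
          · refine Or.inr ⟨hb, ?_⟩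
            rcases Nat.le_succ_iff.1 hj with hj | rfl
            · exact absurd ⟨j, hj, h⟩ hb
            · exact h
        · rintro (⟨j, hj, h⟩ | ⟨-, h⟩)
          · exact ⟨j, hj.trans (Nat.le_succ t), h⟩
          · exact ⟨t + 1, le_rfl, h⟩
      have e2 : (B ∪ (Bᶜ ∩ D))ᶜ = Bᶜ \ D := by
        ext ω; simp only [Set.mem_compl_iff, Set.mem_union, Set.mem_inter_iff, Set.mem_sdiff]; tauto
      rw [e1, e2]
      calc c * μ (B ∪ (Bᶜ ∩ D)) + ∫⁻ ω in Bᶜ \ D, W (t + 1) ω ∂μ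
          ≤ (c * μ B + c * μ (Bᶜ ∩ D)) + ∫⁻ ω in Bᶜ \ D, W (t + 1) ω ∂μ := by
            rw [← mul_add]; gcongr; exact measure_union_le _ _
        _ ≤ (c * μ B + ∫⁻ ω in Bᶜ ∩ D, W (t + 1) ω ∂μ) + ∫⁻ ω in Bᶜ \ D, W (t + 1) ω ∂μ := by
            gcongr; exact low (t + 1) _ (hBt.compl.inter hDt) Set.inter_subset_right
        _ = c * μ B + ∫⁻ ω in Bᶜ, W (t + 1) ω ∂μ := by
            rw [add_assoc, lintegral_inter_add_sdiff _ _ hDt]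
        _ ≤ c * μ B + ∫⁻ ω in Bᶜ, W t ω ∂μ := by
            gcongr c * μ B + ?_
            exact hstep t _ (@MeasurableSet.compl _ _ (ℱ t) (hB t))
        _ ≤ 1 := ih
  have e : {ω | ∃ t, c ≤ W t ω} = ⋃ t, {ω | ∃ j ≤ t, c ≤ W j ω} := by
    ext ω
    simp only [Set.mem_ofPred_eq, Set.mem_iUnion]
    exact ⟨fun ⟨t, h⟩ => ⟨t, t, le_rfl, h⟩, fun ⟨_, j, _, h⟩ => ⟨j, h⟩⟩
  have hmono : Monotone fun t => {ω | ∃ j ≤ t, c ≤ W j ω} :=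
    fun _ _ hst _ ⟨j, hj, h⟩ => ⟨j, hj.trans hst, h⟩
  rw [e, hmono.measure_iUnion, ENNReal.mul_iSup]
  exact iSup_le fun t => le_self_add.trans (key t)

lemma sum_indicator_fiber {γ : Type*} [Fintype γ] (Y : Ω → γ) (F : γ → Ω → ℝ≥0∞) (ω : Ω) :
    ∑ y, {ω | Y ω = y}.indicator (F y) ω = F (Y ω) ω := by
  classical
  simp [Set.indicator_apply]

lemma measurable_comp_of_finite {m : MeasurableSpace Ω} {γ β : Type*} [Finite γ]
    [MeasurableSpace β] {Y : Ω → γ} (hY : ∀ y, MeasurableSet[m] {ω | Y ω = y}) (f : γ → β) :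
    Measurable[m] fun ω => f (Y ω) := by
  intro s _
  have : (fun ω => f (Y ω)) ⁻¹' s = ⋃ y ∈ f ⁻¹' s, {ω | Y ω = y} := by ext; simp
  rw [this]
  exact MeasurableSet.biUnion (Set.to_countable _) fun y _ => hY y

variable {S A : Type*} {H : ℕ} [Fintype S] [Fintype A] [DecidableEq S] [DecidableEq A]
  [Nonempty A] {M : TabularMDP S A H} {δ : ℝ} {r : ℕ → Ω → Reward S A H}
  {π : ℕ → Ω → DetPolicy S A H} {X : ℕ → Ω → Trajectory S A H}

lemma IsUCBVIRun.measurable_policy (hrun : IsUCBVIRun M δ μ ℱ r π X) {β : Type*}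
    [MeasurableSpace β] (t : ℕ) (f : DetPolicy S A H → β) : Measurable[ℱ t] fun ω => f (π t ω) :=
  measurable_comp_of_finite (m := ℱ t) (hrun.policy_measurable t) f

lemma IsUCBVIRun.measurable_trajectory (hrun : IsUCBVIRun M δ μ ℱ r π X) {β : Type*}
    [MeasurableSpace β] {j t : ℕ} (hj : j < t) (f : Trajectory S A H → β) :
    Measurable[ℱ t] fun ω => f (X j ω) :=
  (measurable_comp_of_finite (m := ℱ (j + 1)) (hrun.trajectory_measurable j) f).mono
    (ℱ.mono hj) le_rfl

lemma IsUCBVIRun.measurable_visits (hrun : IsUCBVIRun M δ μ ℱ r π X) (t : ℕ) (h : Fin H) (s : S)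
    (a : A) : Measurable[ℱ t] fun ω => visits (fun j => X j ω) t h s a := by
  simp only [visits, Finset.card_filter]
  exact Finset.measurable_sum (m := ℱ t) _ fun j hj =>
    hrun.measurable_trajectory (Finset.mem_range.1 hj) fun x => if x h = (s, a) then 1 else 0

lemma IsUCBVIRun.measurable_transitions (hrun : IsUCBVIRun M δ μ ℱ r π X) (t : ℕ) (h : Fin H)
    (hh : h.val + 1 < H) (s : S) (a : A) (s' : S) :
    Measurable[ℱ t] fun ω => transitions (fun j => X j ω) t h hh s a s' := by
  simp only [transitions, Finset.card_filter]
  exact Finset.measurable_sum (m := ℱ t) _ fun j hj =>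
    hrun.measurable_trajectory (Finset.mem_range.1 hj)
      fun x => if x h = (s, a) ∧ (x ⟨h.val + 1, hh⟩).1 = s' then 1 else 0

lemma IsUCBVIRun.measurableSet_trajectory (hrun : IsUCBVIRun M δ μ ℱ r π X) (t : ℕ)
    (x : Trajectory S A H) : MeasurableSet {ω | X t ω = x} :=
  ℱ.le _ _ (hrun.trajectory_measurable t x)

variable [IsProbabilityMeasure μ]

lemma IsUCBVIRun.measure_inter (hrun : IsUCBVIRun M δ μ ℱ r π X) (t : ℕ) (x : Trajectory S A H)
    {B : Set Ω} (hB : MeasurableSet[ℱ t] B) :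
    μ (B ∩ {ω | X t ω = x}) = ∫⁻ ω in B, ENNReal.ofReal (M.trajProb (π t ω).toPolicy x) ∂μ := by
  have hX := hrun.measurableSet_trajectory t x
  have hint : Integrable ({ω | X t ω = x}.indicator fun _ => (1 : ℝ)) μ :=
    (integrable_const 1).indicator hX
  have h1 := setIntegral_condExp (ℱ.le t) hint hB
  rw [setIntegral_congr_ae (g := fun ω => M.trajProb (π t ω).toPolicy x) (ℱ.le t _ hB)
    ((hrun.trajectory_law t x).mono fun ω hω _ => hω)] at h1
  have hint2 : Integrable (fun ω => M.trajProb (π t ω).toPolicy x) μ :=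
    integrable_condExp.congr (hrun.trajectory_law t x)
  rw [← ofReal_integral_eq_lintegral_ofReal hint2.integrableOn
    (Filter.Eventually.of_forall fun ω => M.trajProb_nonneg _ x), h1,
    integral_indicator_const _ hX, smul_eq_mul, mul_one, measureReal_def,
    ENNReal.ofReal_toReal (measure_ne_top _ _), Measure.restrict_apply hX, Set.inter_comm]

/-- Restriction to `{X t = x}` and the density given by the conditional law define the same measure
on `ℱ t`, hence integrate `ℱ t`-measurable functions alike. -/
lemma IsUCBVIRun.setLIntegral_trajectory (hrun : IsUCBVIRun M δ μ ℱ r π X) (t : ℕ)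
    (x : Trajectory S A H) {Y : Ω → ℝ≥0∞} (hY : Measurable[ℱ t] Y) :
    ∫⁻ ω in {ω | X t ω = x}, Y ω ∂μ =
      ∫⁻ ω, ENNReal.ofReal (M.trajProb (π t ω).toPolicy x) * Y ω ∂μ := by
  have hg : Measurable[ℱ t] fun ω => ENNReal.ofReal (M.trajProb (π t ω).toPolicy x) :=
    hrun.measurable_policy t fun π => ENNReal.ofReal (M.trajProb π.toPolicy x)
  have hg' := hg.mono (ℱ.le t) le_rfl
  have htrim : (μ.restrict {ω | X t ω = x}).trim (ℱ.le t) =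
      (μ.withDensity fun ω => ENNReal.ofReal (M.trajProb (π t ω).toPolicy x)).trim (ℱ.le t) := by
    refine @Measure.ext _ (ℱ t) _ _ fun B hB => ?_
    rw [trim_measurableSet_eq _ hB, trim_measurableSet_eq _ hB,
      Measure.restrict_apply (ℱ.le t _ hB), withDensity_apply _ (ℱ.le t _ hB),
      hrun.measure_inter t x hB]
  rw [← lintegral_trim (ℱ.le t) hY, htrim, lintegral_trim (ℱ.le t) hY,
    lintegral_withDensity_eq_lintegral_mul _ hg' (hY.mono (ℱ.le t) le_rfl)]
  rfl

/-- The trajectories have positive probability. -/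
lemma IsUCBVIRun.ae_trajProb_pos (hrun : IsUCBVIRun M δ μ ℱ r π X) :
    ∀ᵐ ω ∂μ, ∀ t, 0 < M.trajProb (π t ω).toPolicy (X t ω) := by
  refine ae_all_iff.2 fun t => ?_
  have h1 : ∀ x, ∀ᵐ ω ∂μ, X t ω = x → 0 < M.trajProb (π t ω).toPolicy x := by
    intro x
    have hB : MeasurableSet[ℱ t] {ω | M.trajProb (π t ω).toPolicy x = 0} :=
      (hrun.measurable_policy t fun π => M.trajProb π.toPolicy x) (measurableSet_singleton 0)
    have h2 := hrun.measure_inter t x hB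
    rw [setLIntegral_congr_fun (g := fun _ => 0) (ℱ.le t _ hB) (fun ω hω => by
      change M.trajProb (π t ω).toPolicy x = 0 at hω
      simp only [hω, ENNReal.ofReal_zero]), lintegral_zero] at h2
    filter_upwards [measure_eq_zero_iff_ae_notMem.1 h2] with ω hω hx
    exact lt_of_le_of_ne (M.trajProb_nonneg _ x) fun h0 => hω ⟨h0.symm, hx⟩
  filter_upwards [ae_all_iff.2 h1] with ω hω
  exact hω _ rfl

/-- The supermartingale step: split over the finitely many trajectories and replace each indicator
by its conditional probability. -/
lemma IsUCBVIRun.setLIntegral_mul_le (hrun : IsUCBVIRun M δ μ ℱ r π X) (t : ℕ)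
    {G : Trajectory S A H → Ω → ℝ≥0∞} (hG : ∀ x, Measurable[ℱ t] (G x))
    (hsum : ∀ ω, ∑ x, ENNReal.ofReal (M.trajProb (π t ω).toPolicy x) * G x ω ≤ 1)
    {W : Ω → ℝ≥0∞} (hW : Measurable[ℱ t] W) {B : Set Ω} (hB : MeasurableSet[ℱ t] B) :
    ∫⁻ ω in B, W ω * G (X t ω) ω ∂μ ≤ ∫⁻ ω in B, W ω ∂μ := by
  have hY : ∀ x, Measurable[ℱ t] (B.indicator fun ω => W ω * G x ω) := fun x =>
    Measurable.indicator (hW.mul (hG x)) hB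
  have hg : ∀ x, Measurable fun ω => ENNReal.ofReal (M.trajProb (π t ω).toPolicy x) := fun x =>
    (hrun.measurable_policy t fun π => ENNReal.ofReal (M.trajProb π.toPolicy x)).mono
      (ℱ.le t) le_rfl
  have hY' := fun x => (hY x).mono (ℱ.le t) le_rfl
  have e1 : ∀ ω, B.indicator (fun ω => W ω * G (X t ω) ω) ω =
      ∑ x, {ω | X t ω = x}.indicator (B.indicator fun ω => W ω * G x ω) ω := by
    intro ω
    rw [sum_indicator_fiber (X t) fun x => B.indicator fun ω => W ω * G x ω]
    by_cases hω : ω ∈ B <;> simp [hω]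
  rw [← lintegral_indicator (ℱ.le t _ hB), ← lintegral_indicator (ℱ.le t _ hB)]
  simp only [e1]
  rw [lintegral_finsetSum _ fun x _ => (hY' x).indicator (hrun.measurableSet_trajectory t x)]
  simp only [lintegral_indicator (hrun.measurableSet_trajectory t _),
    hrun.setLIntegral_trajectory t _ (hY _)]
  rw [← lintegral_finsetSum (f := fun x ω => ENNReal.ofReal (M.trajProb (π t ω).toPolicy x) *
    B.indicator (fun ω => W ω * G x ω) ω) _ fun x _ => (hg x).mul (hY' x)]
  refine lintegral_mono fun ω => ?_
  by_cases hω : ω ∈ B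
  · simp only [Set.indicator_of_mem hω]
    calc _ = W ω * ∑ x, ENNReal.ofReal (M.trajProb (π t ω).toPolicy x) * G x ω := by
          rw [Finset.mul_sum]; exact Finset.sum_congr rfl fun x _ => by ring
      _ ≤ W ω * 1 := by gcongr; exact hsum ω
      _ = W ω := mul_one _
  · simp [hω]

/-- A product of conditional likelihood ratios of the trajectories rarely becomes large. -/
lemma IsUCBVIRun.measure_exists_le_prod_le (hrun : IsUCBVIRun M δ μ ℱ r π X)
    {g : ℕ → Trajectory S A H → Ω → ℝ} (hg0 : ∀ t x ω, 0 ≤ g t x ω)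
    (hg : ∀ t x, Measurable[ℱ t] (g t x))
    (hsum : ∀ t ω, ∑ x, M.trajProb (π t ω).toPolicy x * g t x ω ≤ 1) {c : ℝ} (hc : 0 < c) :
    μ {ω | ∃ t, c ≤ ∏ j ∈ Finset.range t, g j (X j ω) ω} ≤ ENNReal.ofReal c⁻¹ := by
  let W : ℕ → Ω → ℝ≥0∞ := fun t ω => ∏ j ∈ Finset.range t, ENNReal.ofReal (g j (X j ω) ω)
  have hW : ∀ t, Measurable[ℱ t] (W t) := fun t =>
    Finset.measurable_prod (m := ℱ t) _ fun j hj => by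
      have e : (fun ω => ENNReal.ofReal (g j (X j ω) ω)) =
          fun ω => ∑ x, {ω | X j ω = x}.indicator (fun ω => ENNReal.ofReal (g j x ω)) ω := by
        funext ω
        rw [sum_indicator_fiber (X j) fun x ω => ENNReal.ofReal (g j x ω)]
      have hjt := Finset.mem_range.1 hj
      rw [e]
      exact Finset.measurable_sum (m := ℱ t) _ fun x _ => Measurable.indicator
        ((hg j x).ennreal_ofReal.mono (ℱ.mono hjt.le) le_rfl)
        (ℱ.mono hjt _ (hrun.trajectory_measurable j x))
  have h1 := mul_measure_exists_le_le_one (μ := μ) hW (by simp [W]) (fun t B hB => by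
    simp only [W, Finset.prod_range_succ]
    refine hrun.setLIntegral_mul_le t (G := fun x ω => ENNReal.ofReal (g t x ω))
      (fun x => (hg t x).ennreal_ofReal) (fun ω => ?_) (hW t) hB
    simp only [← ENNReal.ofReal_mul (M.trajProb_nonneg _ _)]
    rw [← ENNReal.ofReal_sum_of_nonneg fun x _ => mul_nonneg (M.trajProb_nonneg _ _) (hg0 _ _ _)]
    exact ENNReal.ofReal_le_one.2 (hsum t ω)) (ENNReal.ofReal c)
  have h2 : {ω | ∃ t, c ≤ ∏ j ∈ Finset.range t, g j (X j ω) ω} =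
      {ω | ∃ t, ENNReal.ofReal c ≤ W t ω} := by
    ext ω
    simp only [W, Set.mem_ofPred_eq, ← ENNReal.ofReal_prod_of_nonneg fun j _ => hg0 j (X j ω) ω,
      ENNReal.ofReal_le_ofReal_iff (Finset.prod_nonneg fun j _ => hg0 j (X j ω) ω)]
  rw [h2, ENNReal.ofReal_inv_of_pos hc, ← one_div, ENNReal.le_div_iff_mul_le (by simp [hc])
    (by simp), mul_comm]
  exact h1

/-- Exponential supermartingale with factors `exp (u / 2 - 1)` on a visit and `exp (u / 2)`
otherwise, `u` being the occupancy. The conditional mean is `exp (u / 2) (1 - u (1 - exp (-1)))`, at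
most `1` because `exp (-1) ≤ 1 / 2`. -/
lemma IsUCBVIRun.measure_visits_le (hrun : IsUCBVIRun M δ μ ℱ r π X) (hδ₀ : 0 < δ) (hδ₁ : δ < 1)
    (h : Fin H) (s : S) (a : A) :
    μ {ω | ∃ t, (visits (fun j => X j ω) t h s a : ℝ) <
      (∑ j ∈ Finset.range t, M.occupancy (π j ω).toPolicy h s a) / 2 - logTerm S A H δ} ≤
      ENNReal.ofReal (2 * Fintype.card S * Fintype.card A * H / δ)⁻¹ := by
  have : Nonempty S := ⟨M.s₁⟩
  have hc := two_le_card_div (S := S) (A := A) h.pos hδ₀ hδ₁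
  refine le_trans (measure_mono ?_) (hrun.measure_exists_le_prod_le
    (g := fun t x ω => Real.exp (M.occupancy (π t ω).toPolicy h s a / 2 -
      if x h = (s, a) then 1 else 0)) (fun _ _ _ => (Real.exp_pos _).le)
    (fun t x => hrun.measurable_policy t fun π => Real.exp (M.occupancy π.toPolicy h s a / 2 -
      if x h = (s, a) then 1 else 0)) (fun t ω => ?_)
    (c := 2 * Fintype.card S * Fintype.card A * H / δ) (by linarith))
  · rintro ω ⟨t, ht⟩
    refine ⟨t, ?_⟩
    rw [← Real.exp_sum, ← Real.log_le_iff_le_exp (by linarith), Finset.sum_sub_distrib,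
      ← Finset.sum_div]
    have e : ∑ j ∈ Finset.range t, (if X j ω h = (s, a) then (1 : ℝ) else 0) =
        visits (fun j => X j ω) t h s a := by
      simp [visits]
    rw [e]
    rw [logTerm] at ht
    linarith
  · set u := M.occupancy (π t ω).toPolicy h s a
    have e1 := M.sum_trajProb_mul (π t ω).toPolicy h
      (fun z => Real.exp (u / 2 - if z = (s, a) then 1 else 0))
    rw [e1]
    have e2 : ∀ z : S × A, M.occupancy (π t ω).toPolicy h z.1 z.2 *
        Real.exp (u / 2 - if z = (s, a) then 1 else 0) =
        Real.exp (u / 2) * (M.occupancy (π t ω).toPolicy h z.1 z.2 -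
          if z = (s, a) then u * (1 - Real.exp (-1)) else 0) := by
      intro z
      split_ifs with hz
      · subst hz
        rw [sub_eq_add_neg, Real.exp_add]
        simp only [u]
        ring
      · ring_nf
    simp only [e2, ← Finset.mul_sum, Finset.sum_sub_distrib, M.sum_occupancy, Finset.sum_ite_eq',
      Finset.mem_univ, if_true]
    have hu : 0 ≤ u := M.occupancy_nonneg _ _ _ _
    have h3 : Real.exp (-1) ≤ 1 / 2 := by
      rw [Real.exp_neg, one_div]
      exact inv_anti₀ (by norm_num) (by linarith [Real.exp_one_gt_d9])
    have h4 : 1 - u * (1 - Real.exp (-1)) ≤ Real.exp (-(u / 2)) := by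
      have := Real.add_one_le_exp (-(u / 2))
      nlinarith
    calc _ ≤ Real.exp (u / 2) * Real.exp (-(u / 2)) :=
          mul_le_mul_of_nonneg_left h4 (Real.exp_pos _).le
      _ = 1 := by rw [← Real.exp_add, add_neg_cancel, Real.exp_zero]

lemma IsUCBVIRun.measurable_laplaceRatio (hrun : IsUCBVIRun M δ μ ℱ r π X) (h : Fin H)
    (hh : h.val + 1 < H) (s : S) (a : A) (t : ℕ) (x : Trajectory S A H) :
    Measurable[ℱ t] fun ω => laplaceRatio M h hh s a (fun j => X j ω) t x := by
  unfold laplaceRatio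
  split_ifs
  · have h1 := hrun.measurable_transitions t h hh s a (x ⟨h.val + 1, hh⟩).1
    have h2 := hrun.measurable_visits t h s a
    exact (((measurable_from_top (f := fun n : ℕ => ((n + 1 : ℕ) : ℝ))).comp h1).div
      ((measurable_from_top (f := fun n : ℕ => ((n + Fintype.card S : ℕ) : ℝ))).comp h2)).div_const _
  · exact measurable_const

/-- Having `hh` inside the event makes it empty at the last stage, so that the union bound can run
over all stages. -/
lemma IsUCBVIRun.measure_laplaceRatio_le (hrun : IsUCBVIRun M δ μ ℱ r π X) (hδ₀ : 0 < δ)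
    (hδ₁ : δ < 1) (h : Fin H) (s : S) (a : A) :
    μ {ω | ∃ (hh : h.val + 1 < H) (t : ℕ), 2 * Fintype.card S * Fintype.card A * H / δ ≤
      ∏ j ∈ Finset.range t, laplaceRatio M h hh s a (fun j => X j ω) j (X j ω)} ≤
      ENNReal.ofReal (2 * Fintype.card S * Fintype.card A * H / δ)⁻¹ := by
  have : Nonempty S := ⟨M.s₁⟩
  have hc := two_le_card_div (S := S) (A := A) h.pos hδ₀ hδ₁
  by_cases hh : h.val + 1 < H
  · simp only [hh, exists_true_left]
    exact hrun.measure_exists_le_prod_le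
      (g := fun t x ω => laplaceRatio M h hh s a (fun j => X j ω) t x)
      (fun _ _ _ => laplaceRatio_nonneg M h hh s a _ _ _)
      (fun t x => hrun.measurable_laplaceRatio h hh s a t x)
      (fun t ω => sum_trajProb_mul_laplaceRatio_le M _ h hh s a _ t) (by linarith)
  · simp [hh]

lemma TabularMDP.transition_pos {ρ : Policy S A H} {x : Trajectory S A H}
    (hx : 0 < M.trajProb ρ x) {h : Fin H} (hh : h.val + 1 < H) {s : S} {a : A}
    (hxh : x h = (s, a)) : 0 < M.p h s a (x ⟨h.val + 1, hh⟩).1 := by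
  have h1 := (Finset.prod_ne_zero_iff.1 hx.ne') ⟨h.val + 1, hh⟩ (Finset.mem_univ _)
  have h2 := left_ne_zero_of_mul h1
  simp only [TabularMDP.entryProb, Nat.succ_ne_zero, if_false, Nat.add_sub_cancel, Fin.eta,
    hxh] at h2
  exact lt_of_le_of_ne ((M.p_mem h s a).1 _) h2.symm

/-- The concentration events fail with probability at most `δ`. -/
lemma IsUCBVIRun.measure_not_concentrate_le (hrun : IsUCBVIRun M δ μ ℱ r π X) (hδ₀ : 0 < δ)
    (hδ₁ : δ < 1) (hH : 0 < H) :
    μ {ω | ¬ (TransitionsConcentrate M δ (fun j => X j ω) ∧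
      VisitsConcentrate M δ (fun j => X j ω) fun j => π j ω)} ≤ ENNReal.ofReal δ := by
  have : Nonempty S := ⟨M.s₁⟩
  set c : ℝ := 2 * Fintype.card S * Fintype.card A * H / δ with hc
  have hc2 : 2 ≤ c := two_le_card_div hH hδ₀ hδ₁
  let E₁ : Fin H × S × A → Set Ω := fun i => {ω | ∃ (hh : i.1.val + 1 < H) (t : ℕ), c ≤
      ∏ j ∈ Finset.range t, laplaceRatio M i.1 hh i.2.1 i.2.2 (fun j => X j ω) j (X j ω)}
  let E₂ : Fin H × S × A → Set Ω := fun i => {ω | ∃ t,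
      (visits (fun j => X j ω) t i.1 i.2.1 i.2.2 : ℝ) <
      (∑ j ∈ Finset.range t, M.occupancy (π j ω).toPolicy i.1 i.2.1 i.2.2) / 2 - logTerm S A H δ}
  have hsub : {ω | ¬ (TransitionsConcentrate M δ (fun j => X j ω) ∧
      VisitsConcentrate M δ (fun j => X j ω) fun j => π j ω)} ⊆
      {ω | ¬ ∀ t, 0 < M.trajProb (π t ω).toPolicy (X t ω)} ∪ ⋃ i, (E₁ i ∪ E₂ i) := by
    intro ω hω
    by_contra hcon
    simp only [Set.mem_union, Set.mem_ofPred_eq, Set.mem_iUnion, not_or, not_exists, not_not] at hcon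
    obtain ⟨hpos, hE⟩ := hcon
    refine hω ⟨fun t h hh s a hv => ?_, fun t h s a => ?_⟩
    · refine dvBound_of_prod_laplaceRatio_lt M hδ₀ hδ₁ h hh s a _
        (fun j hj => M.transition_pos (hpos j) hh hj) t ?_ hv
      exact not_le.1 fun hle => (hE (h, s, a)).1 ⟨hh, t, hle⟩
    · exact not_lt.1 fun hlt => (hE (h, s, a)).2 ⟨t, hlt⟩
  refine (measure_mono hsub).trans ((measure_union_le _ _).trans ?_)
  have h0 : μ {ω | ¬ ∀ t, 0 < M.trajProb (π t ω).toPolicy (X t ω)} = 0 :=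
    ae_iff.1 hrun.ae_trajProb_pos
  rw [h0, zero_add]
  calc μ (⋃ i, (E₁ i ∪ E₂ i)) ≤ ∑ i, μ (E₁ i ∪ E₂ i) := measure_iUnion_fintype_le _ _
    -- Two failure events for each of the `S A H` triples, each of probability at most `δ / (2 S A
    -- H)`.
    _ ≤ ∑ _i : Fin H × S × A, (ENNReal.ofReal c⁻¹ + ENNReal.ofReal c⁻¹) :=
        Finset.sum_le_sum fun i _ => (measure_union_le _ _).trans
          (add_le_add (hrun.measure_laplaceRatio_le hδ₀ hδ₁ _ _ _)
            (hrun.measure_visits_le hδ₀ hδ₁ _ _ _))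
    _ = ENNReal.ofReal δ := by
        have hcinv : 0 ≤ c⁻¹ := by positivity
        rw [← ENNReal.ofReal_add hcinv hcinv, Finset.sum_const, nsmul_eq_mul,
          ← ENNReal.ofReal_natCast, ← ENNReal.ofReal_mul (Nat.cast_nonneg _)]
        congr 1
        have hS : (Fintype.card S : ℝ) ≠ 0 := by simp
        have hA : (Fintype.card A : ℝ) ≠ 0 := by simp
        have hH' : (H : ℝ) ≠ 0 := by positivity
        simp only [hc, Finset.card_univ, Fintype.card_prod, Fintype.card_fin]
        push_cast
        field_simp
        norm_num

end Probability

end ChangingRewardRL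

theorem mainTheorem8 {S A : Type*} [Fintype S] [Fintype A] [DecidableEq S] [DecidableEq A]
    [Nonempty A] {H : ℕ} (M : ChangingRewardRL.TabularMDP S A H)
    (δ : ℝ) (hδ₀ : 0 < δ) (hδ₁ : δ < 1)
    {Ω : Type*} {mΩ : MeasurableSpace Ω} (μ : MeasureTheory.Measure Ω)
    [MeasureTheory.IsProbabilityMeasure μ] (ℱ : MeasureTheory.Filtration ℕ mΩ)
    (r : ℕ → Ω → ChangingRewardRL.Reward S A H)
    (π : ℕ → Ω → ChangingRewardRL.DetPolicy S A H)
    (X : ℕ → Ω → ChangingRewardRL.Trajectory S A H)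
    (hr : ∀ t ω, (r t ω).IsAdmissible)
    (hrun : ChangingRewardRL.IsUCBVIRun M δ μ ℱ r π X) :
    1 - δ ≤ μ.real {ω | ∀ T : ℕ,
      ∑ t ∈ Finset.range T, (M.optValue (r t ω) - M.value (π t ω).toPolicy (r t ω)) ≤
        5140 * Fintype.card S * Fintype.card A * H ^ 2 * ChangingRewardRL.logFactor S A H δ T +
          256 * Real.sqrt (Fintype.card S * Fintype.card A * H *
            ChangingRewardRL.logFactor S A H δ T *
            ∑ t ∈ Finset.range T, M.value (π t ω).toPolicy (r t ω))} := by
  rcases Nat.eq_zero_or_pos H with rfl | hH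
  · have h1 : ∀ r : ChangingRewardRL.Reward S A 0, M.optValue r = 0 := fun r => by
      simp [ChangingRewardRL.TabularMDP.optValue, ChangingRewardRL.TabularMDP.value]
    have h2 : ∀ (ρ : ChangingRewardRL.Policy S A 0) (r : ChangingRewardRL.Reward S A 0),
        M.value ρ r = 0 := fun ρ r => by simp [ChangingRewardRL.TabularMDP.value]
    simp [h1, h2, hδ₀.le]
  · set G := {ω | ∀ T : ℕ,
      ∑ t ∈ Finset.range T, (M.optValue (r t ω) - M.value (π t ω).toPolicy (r t ω)) ≤
        5140 * Fintype.card S * Fintype.card A * H ^ 2 * ChangingRewardRL.logFactor S A H δ T +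
          256 * Real.sqrt (Fintype.card S * Fintype.card A * H *
            ChangingRewardRL.logFactor S A H δ T *
            ∑ t ∈ Finset.range T, M.value (π t ω).toPolicy (r t ω))}
    have hbad : μ Gᶜ ≤ ENNReal.ofReal δ := by
      refine (MeasureTheory.measure_mono fun ω hω => ?_).trans
        (hrun.measure_not_concentrate_le hδ₀ hδ₁ hH)
      exact fun hconc => hω fun T => hconc.1.regret_le hconc.2 hδ₀ hδ₁ hH (fun t => hr t ω)
        (fun t h s a => hrun.greedy t ω h s a) T
    have hbad' : μ.real Gᶜ ≤ δ := ENNReal.toReal_le_of_le_ofReal hδ₀.le hbad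
    -- Subadditivity suffices, so measurability of `G` is not needed.
    have hone : (1 : ℝ) ≤ μ.real G + μ.real Gᶜ := by
      have h1 := MeasureTheory.measureReal_union_le (μ := μ) G Gᶜ
      rwa [Set.union_compl_self, MeasureTheory.probReal_univ] at h1
    linarith
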